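/- Let $d\ge 0$, let $U:\mathbb{R}^d\to\mathbb{R}$ be continuously differentiable with $\int_{\mathbb{R}^d} e^{-U(x)}\,dx<\infty$, let $\pi(x)\propto e^{-U(x)}$, and let $\lambda_{\mathrm{ref}}>0$. Let $\mathcal{V}=\{0\}\cup\{\pm e_i: i=1,\dots,d\}$, where $(e_i)$ is the canonical basis of $\mathbb{R}^d$, let $\varphi$ be the uniform distribution on $\mathcal{V}$, and let $\pi(dx,dv)=\pi(x)\,dx\,\varphi(dv)$ on $\mathbb{R}^d\times\mathcal{V}$. Put $$\lambda(x,v)=\max(\langle v,\nabla U(x)\rangle,0)+\lambda_{\mathrm{ref}},\qquad \lambda(x)=\sum_{w\in\mathcal{V}}\lambda(x,w).$$ The on-and-off coordinate sampler is the piecewise deterministic process $Z_t=(X_t,V_t)$ on $\mathbb{R}^d\times\mathcal{V}$ defined as follows. Between events, $\dot X_t=V_t$ and $\dot V_t=0$. From a state $(x,v)$, the duration until the next event is the first event time of a Poisson process with intensity $t\mapsto\lambda(x+tv,v)$, that is, it has density $\lambda(x+tv,v)\exp\left(-\int_0^t\lambda(x+sv,v)\,ds\right)$ on $(0,\infty)$.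 At an event at position $x$, the velocity is replaced by a new one, drawn from $\mathcal{V}$ with probabilities proportional to $\lambda(x,-w)$, $w\in\mathcal{V}$. Let $P_t(z,\cdot)$ be the law of $Z_t$ given $Z_0=z$. Then: 1. The process is well defined for all times: for every initial state, almost surely the successive event times $0=T_0<T_1<T_2<\cdots$ are strictly increasing and tend to $\infty$. 2. The sampler is $\pi$-invariant: $\pi$ is a probability measure on $\mathbb{R}^d\times\mathcal{V}$, and for every $t\ge 0$, $P_t$ is a Markov kernel and $\pi P_t=\pi$, i.e. if $Z_0\sim\pi$ then $Z_t\sim\pi$. 3. $\pi$ is infinitesimally invariant: for $$\mathcal{L}f(x,v)=\langle\nabla_x f(x,v),v\rangle+\lambda(x,v)\sum_{w\in\mathcal{V}}\frac{\lambda(x,-w)}{\lambda(x)}f(x,w)-\lambda(x,v)f(x,v)$$ and every $f:\mathbb{R}^d\times\mathcal{V}\to\mathbb{R}$ that is differentiable in $x$ and for which $\langle\nabla_x f(x,v),v\rangle$, $\lambda(x,v)f(x,v)$ and $\lambda(x,-v)f(x,v)$ are $\pi$-integrable, $\mathcal{L}f$ is $\pi$-integrable and $\int\mathcal{L}f\,d\pi=0$.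 -/

import Mathlib

open MeasureTheory ProbabilityTheory Filter

namespace IOCS

noncomputable section

/-- The position space `ℝ^d` with its Euclidean structure. -/
abbrev Pos (d : ℕ) : Type := EuclideanSpace ℝ (Fin d)

open Classical in
/-- The velocity set `{0} ∪ {e_i} ∪ {-e_i}`, with `2 d + 1` elements. -/
def velocities (d : ℕ) : Finset (Pos d) :=
  insert 0
    (Finset.univ.image (fun i : Fin d => EuclideanSpace.single i (1 : ℝ)) ∪
      Finset.univ.image (fun i : Fin d => -EuclideanSpace.single i (1 : ℝ)))

/-- The velocity set as a type. -/
abbrev Vel (d : ℕ) : Type := ↥(velocities d)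

/-- States `(x, v)`. -/
abbrev State (d : ℕ) : Type := Pos d × Vel d

/-- One entry `(T_n, (X_{T_n}, V_{T_n}))` of the skeleton of the process: the time of the `n`-th
event and the state just after it. -/
abbrev Mark (d : ℕ) : Type := ℝ × State d

variable {d : ℕ}

/-- The event rate `λ(x, v) = ⟨v, ∇U(x)⟩₊ + λ_ref`. -/
def rate (U : Pos d → ℝ) (lref : ℝ) (x v : Pos d) : ℝ :=
  max (inner ℝ v (gradient U x)) 0 + lref

/-- `λ(x) = ∑_v λ(x, v)`, the sum being over the velocity set. -/
def totalRate (U : Pos d → ℝ) (lref : ℝ) (x : Pos d) : ℝ :=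
  ∑ v : Vel d, rate U lref x v

/-- The density at `t > 0` of the duration until the first event of the Poisson process with
intensity `t ↦ λ(x + t v, v)`. -/
def holdDensity (U : Pos d → ℝ) (lref : ℝ) (z : State d) (t : ℝ) : ℝ :=
  rate U lref (z.1 + t • (z.2 : Pos d)) z.2 *
    Real.exp (-∫ s in (0 : ℝ)..t, rate U lref (z.1 + s • (z.2 : Pos d)) z.2)

/-- The law of the duration until the next event, given the current state. -/
def holdKernel (U : Pos d → ℝ) (lref : ℝ) : Kernel (State d) ℝ :=
  (Kernel.const (State d) (volume.restrict (Set.Ioi (0 : ℝ)))).withDensity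
    (fun z t => ENNReal.ofReal (holdDensity U lref z t))

/-- The probability of picking the velocity `w` at an event at position `x`: proportional to
`λ(x, -w)`. -/
def velProb (U : Pos d → ℝ) (lref : ℝ) (x : Pos d) (w : Vel d) : ℝ :=
  rate U lref x (-(w : Pos d)) / ∑ w' : Vel d, rate U lref x (-(w' : Pos d))

/-- The law of the new velocity at an event, given the position of the event. -/
def velKernel (U : Pos d → ℝ) (lref : ℝ) : Kernel (Pos d) (Vel d) :=
  (Kernel.const (Pos d) Measure.count).withDensity
    (fun x w => ENNReal.ofReal (velProb U lref x w))

/-- The position after following the flow `ẋ = v`, `v̇ = 0` during a time `t`. -/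
def flowPos (z : State d) (t : ℝ) : Pos d := z.1 + t • (z.2 : Pos d)

/-- The next skeleton entry, from the current one, the duration `τ` until the next event and the
velocity `w` picked there. -/
def nextMark (p : Mark d × (ℝ × Vel d)) : Mark d :=
  (p.1.1 + p.2.1, (flowPos p.1.2 p.2.1, p.2.2))

/-- The law of the duration until the next event together with the velocity picked there. -/
def eventKernel (U : Pos d → ℝ) (lref : ℝ) : Kernel (State d) (ℝ × Vel d) :=
  holdKernel U lref ⊗ₖ
    Kernel.comap (velKernel U lref) (fun p : State d × ℝ => flowPos p.1 p.2)
      (by unfold flowPos; fun_prop)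

/-- The transition kernel of the skeleton chain. -/
def stepKernel (U : Pos d → ℝ) (lref : ℝ) : Kernel (Mark d) (Mark d) :=
  (Kernel.id ×ₖ Kernel.comap (eventKernel U lref) Prod.snd measurable_snd).map nextMark

lemma measurable_nextMark : Measurable (nextMark (d := d)) := by
  unfold nextMark flowPos
  fun_prop

lemma continuous_rate {U : Pos d → ℝ} (hU : ContDiff ℝ 1 U) (lref : ℝ) :
    Continuous (fun p : Pos d × Pos d => rate U lref p.1 p.2) := by
  have h : Continuous (gradient U) := by
    have h1 : Continuous (fderiv ℝ U) := hU.continuous_fderiv (by norm_num)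
    exact (LinearIsometryEquiv.continuous _).comp h1
  unfold rate
  fun_prop

lemma rate_ge (U : Pos d → ℝ) (lref : ℝ) (x v : Pos d) : lref ≤ rate U lref x v := by
  unfold rate
  linarith [le_max_right (inner ℝ v (gradient U x)) 0]

lemma continuous_holdDensity {U : Pos d → ℝ} (hU : ContDiff ℝ 1 U) (lref : ℝ) :
    Continuous (fun p : State d × ℝ => holdDensity U lref p.1 p.2) := by
  have hr := continuous_rate hU lref
  have h1 : Continuous (fun p : State d × ℝ =>
      rate U lref (p.1.1 + p.2 • (p.1.2 : Pos d)) p.1.2) :=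
    hr.comp (f := fun p : State d × ℝ => (p.1.1 + p.2 • (p.1.2 : Pos d), (p.1.2 : Pos d)))
      (by fun_prop)
  have h2 : Continuous (fun p : State d × ℝ =>
      ∫ s in (0 : ℝ)..p.2, rate U lref (p.1.1 + s • (p.1.2 : Pos d)) p.1.2) := by
    apply intervalIntegral.continuous_parametric_intervalIntegral_of_continuous
    · exact hr.comp (f := fun q : (State d × ℝ) × ℝ =>
        (q.1.1.1 + q.2 • (q.1.1.2 : Pos d), (q.1.1.2 : Pos d))) (by fun_prop)
    · fun_prop
  unfold holdDensity
  exact h1.mul (Real.continuous_exp.comp h2.neg)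

lemma lintegral_holdDensity {U : Pos d → ℝ} (hU : ContDiff ℝ 1 U) {lref : ℝ} (hl : 0 < lref)
    (z : State d) :
    ∫⁻ t in Set.Ioi (0 : ℝ), ENNReal.ofReal (holdDensity U lref z t) = 1 := by
  set r : ℝ → ℝ := fun s => rate U lref (z.1 + s • (z.2 : Pos d)) z.2 with hrdef
  have hr : Continuous r := (continuous_rate hU lref).comp
    (f := fun s : ℝ => (z.1 + s • (z.2 : Pos d), (z.2 : Pos d))) (by fun_prop)
  have hge : ∀ s, lref ≤ r s := fun s => rate_ge _ _ _ _
  have hder : ∀ t ∈ Set.Ici (0 : ℝ), HasDerivAt (fun t => -Real.exp (-∫ s in (0 : ℝ)..t, r s))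
      (holdDensity U lref z t) t := by
    intro t _
    have h := (hr.integral_hasStrictDerivAt 0 t).hasDerivAt
    have h2 := h.neg.exp.neg
    refine h2.congr_deriv ?_
    simp only [holdDensity, hrdef, Pi.neg_apply]
    ring
  have hnn : ∀ t ∈ Set.Ioi (0 : ℝ), 0 ≤ holdDensity U lref z t := fun t _ =>
    mul_nonneg (hl.le.trans (rate_ge _ _ _ _)) (Real.exp_pos _).le
  have hlim : Tendsto (fun t => -Real.exp (-∫ s in (0 : ℝ)..t, r s)) atTop (nhds 0) := by
    have h1 : Tendsto (fun t => ∫ s in (0 : ℝ)..t, r s) atTop atTop := by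
      refine tendsto_atTop_mono' atTop ?_ (tendsto_id.const_mul_atTop hl)
      filter_upwards [eventually_ge_atTop (0 : ℝ)] with t ht
      have := intervalIntegral.integral_mono_on (μ := volume) ht (f := fun _ => lref) (g := r)
        intervalIntegrable_const (hr.intervalIntegrable _ _) (fun s _ => hge s)
      simpa [mul_comm] using this
    simpa using (Real.tendsto_exp_neg_atTop_nhds_zero.comp h1).neg
  have hint := integrableOn_Ioi_deriv_of_nonneg' hder hnn hlim
  have hval := integral_Ioi_of_hasDerivAt_of_nonneg' hder hnn hlim
  rw [← ofReal_integral_eq_lintegral_ofReal hint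
    ((ae_restrict_iff' measurableSet_Ioi).2 (Eventually.of_forall hnn)), hval]
  simp

lemma isMarkovKernel_holdKernel {U : Pos d → ℝ} (hU : ContDiff ℝ 1 U) {lref : ℝ} (hl : 0 < lref) :
    IsMarkovKernel (holdKernel U lref) := by
  refine ⟨fun z => ⟨?_⟩⟩
  have hm : Measurable (Function.uncurry
      (fun (z : State d) t => ENNReal.ofReal (holdDensity U lref z t))) :=
    ENNReal.measurable_ofReal.comp (continuous_holdDensity hU lref).measurable
  rw [holdKernel, Kernel.withDensity_apply' _ hm, Kernel.const_apply, Measure.restrict_univ,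
    lintegral_holdDensity hU hl]

instance : Nonempty (Vel d) := ⟨⟨0, by simp [velocities]⟩⟩

lemma isMarkovKernel_velKernel {U : Pos d → ℝ} (hU : ContDiff ℝ 1 U) {lref : ℝ} (hl : 0 < lref) :
    IsMarkovKernel (velKernel U lref) := by
  have hr := continuous_rate hU lref
  have hpos : ∀ x : Pos d, 0 < ∑ w' : Vel d, rate U lref x (-(w' : Pos d)) := fun x =>
    Finset.sum_pos (fun w _ => hl.trans_le (rate_ge _ _ _ _)) Finset.univ_nonempty
  have hc : Continuous (fun p : Pos d × Vel d => velProb U lref p.1 p.2) := by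
    unfold velProb
    refine Continuous.div ?_ ?_ (fun p => (hpos p.1).ne')
    · exact hr.comp (f := fun p : Pos d × Vel d => (p.1, -(p.2 : Pos d))) (by fun_prop)
    · refine continuous_finsetSum _ fun w _ => ?_
      exact hr.comp (f := fun p : Pos d × Vel d => (p.1, -(w : Pos d))) (by fun_prop)
  have hm : Measurable (Function.uncurry
      (fun (x : Pos d) (w : Vel d) => ENNReal.ofReal (velProb U lref x w))) :=
    ENNReal.measurable_ofReal.comp hc.measurable
  refine ⟨fun x => ⟨?_⟩⟩
  rw [velKernel, Kernel.withDensity_apply' _ hm, Kernel.const_apply, Measure.restrict_univ,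
    lintegral_count, tsum_fintype, ← ENNReal.ofReal_sum_of_nonneg]
  · simp only [velProb]
    rw [← Finset.sum_div, div_self (hpos x).ne', ENNReal.ofReal_one]
  · exact fun w _ => div_nonneg (hl.le.trans (rate_ge _ _ _ _)) (hpos x).le

lemma isMarkovKernel_stepKernel {U : Pos d → ℝ} (hU : ContDiff ℝ 1 U) {lref : ℝ} (hl : 0 < lref) :
    IsMarkovKernel (stepKernel U lref) := by
  have := isMarkovKernel_holdKernel hU hl
  have := isMarkovKernel_velKernel hU hl
  unfold stepKernel eventKernel
  exact Kernel.IsMarkovKernel.map _ measurable_nextMark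

/-- The kernels of the skeleton chain, as functions of the whole past: the next entry depends only
on the last one. -/
def pastKernel (U : Pos d → ℝ) (lref : ℝ) (n : ℕ) :
    Kernel ((i : Finset.Iic n) → Mark d) (Mark d) :=
  (stepKernel U lref).comap (fun h => h ⟨n, Finset.mem_Iic.2 le_rfl⟩) (measurable_pi_apply _)

/-- The law of the whole skeleton `(T_n, (X_{T_n}, V_{T_n}))_{n ≥ 0}` of the on-and-off coordinate
sampler, given its initial state. -/
def skeletonLaw {U : Pos d → ℝ} (hU : ContDiff ℝ 1 U) {lref : ℝ} (hl : 0 < lref) :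
    Kernel (State d) (ℕ → Mark d) :=
  haveI : IsMarkovKernel (stepKernel U lref) := isMarkovKernel_stepKernel hU hl
  haveI : ∀ n, IsMarkovKernel (pastKernel U lref n) := fun _ =>
    Kernel.IsMarkovKernel.comap _ (measurable_pi_apply _)
  (Kernel.traj (X := fun _ => Mark d) (pastKernel U lref) 0).comap
    (fun z _ => ((0 : ℝ), z)) (by fun_prop)

/-- The number of events up to time `t`, i.e. the first `n` with `t < T_{n+1}`. -/
def eventCount (ω : ℕ → Mark d) (t : ℝ) : ℕ := sInf {n | t < (ω (n + 1)).1}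

/-- The state `Z_t = (X_t, V_t)` of the process at time `t`: since the last event before `t` the
position has moved along the flow and the velocity has not changed. -/
def stateAt (t : ℝ) (ω : ℕ → Mark d) : State d :=
  (flowPos (ω (eventCount ω t)).2 (t - (ω (eventCount ω t)).1), (ω (eventCount ω t)).2.2)

/-- The transition kernel `P_t` of the on-and-off coordinate sampler: the law of `Z_t` given the
state at time `0`. -/
def transition {U : Pos d → ℝ} (hU : ContDiff ℝ 1 U) {lref : ℝ} (hl : 0 < lref) (t : ℝ) :
    Kernel (State d) (State d) :=
  (skeletonLaw hU hl).map (stateAt t)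

/-- The augmented target `π(x) φ(v)`, with `π(x) ∝ exp(-U(x))` and `φ` uniform on the velocity
set. -/
def target (U : Pos d → ℝ) : Measure (State d) :=
  ((volume : Measure (Pos d)).tilted (fun x => -U x)).prod (uniformOn (Set.univ : Set (Vel d)))

/-- The term `⟨∇_x f(x, v), v⟩`. -/
def drift (f : State d → ℝ) (z : State d) : ℝ :=
  inner ℝ (gradient (fun y => f (y, z.2)) z.1) (z.2 : Pos d)

/-- The generator
`L f(x, v) = ⟨∇_x f(x, v), v⟩ + λ(x, v) ∑_w λ(x, -w) / λ(x) f(x, w) - λ(x, v) f(x, v)`. -/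
def generator (U : Pos d → ℝ) (lref : ℝ) (f : State d → ℝ) (z : State d) : ℝ :=
  drift f z
    + rate U lref z.1 z.2 *
        ∑ w : Vel d, rate U lref z.1 (-(w : Pos d)) / totalRate U lref z.1 * f (z.1, w)
    - rate U lref z.1 z.2 * f z

/-- The functions to which the generator formula is applied: differentiable in the position, and
such that every term is integrable with respect to the augmented target. -/
structure Admissible (U : Pos d → ℝ) (lref : ℝ) (f : State d → ℝ) : Prop where
  differentiable : ∀ v : Vel d, Differentiable ℝ (fun x => f (x, v))
  integrable_drift : Integrable (drift f) (target U)
  integrable_rate : Integrable (fun z : State d => rate U lref z.1 z.2 * f z) (target U)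
  integrable_rate_neg :
    Integrable (fun z : State d => rate U lref z.1 (-(z.2 : Pos d)) * f z) (target U)

end

end IOCS

namespace IOCS

open scoped ENNReal

variable {d : ℕ}

/-! Write μ for the measure `refMeasure U`, that is e^{-U(x)} dx times counting measure, and S for
the reversal (x, v) ↦ (x, -v). The process alternates killed flights, φ ↦ `transport U lref r φ`,
and jumps, φ ↦ `jump U lref φ`. In L²(μ) each has its conjugate by S as adjoint. For flights this is
λ(x, v) - λ(x, -v) = ⟨v, ∇U(x)⟩, integrated along a segment (`potential_add_integral_rate`); for
jumps, the rate from v to w is proportional to λ(x, v) λ(x, -w), which is symmetric under (v, w) ↦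
(-w, -v) (`rate_mul_velProb`).

The contribution of paths with exactly n events is an iterated time integral of flights and jumps.
Moving flights and jumps one by one across the pairing shows that its adjoint is again its conjugate
by S (`lintegral_mul_eventTerm`). These contributions sum to P_t (`lintegral_transition`), so P_t* =
S P_t S; since P_t 1 = 1 and S 1 = 1, testing against 1 gives μP_t = μ. All functions take values in
[0, ∞], so Tonelli suffices and no domain of the generator is needed.

That the contributions exhaust P_t is non-explosion. The speed is at most 1, so up to time T the
position stays in a compact ball, on which the rates are bounded by some M. Then E[1_{T_n ≤ T}
e^{-T_n}] ≤ (M/(M+1))^n, which tends to 0.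

Infinitesimal invariance is a separate computation: integration by parts along each velocity
(`integral_exp_mul_drift`), and the fact that the weights λ(x, v)/λ(x) sum to 1 in the gain term
(`integral_gain`). -/

/-! ### Integrals against the kernels and the Markov property of the skeleton -/

lemma measurable_velProb {U : Pos d → ℝ} (hU : ContDiff ℝ 1 U) (lref : ℝ) :
    Measurable (fun p : Pos d × Vel d => velProb U lref p.1 p.2) := by
  have hr := continuous_rate hU lref
  unfold velProb
  refine Measurable.div ?_ (Finset.measurable_sum _ fun w _ => ?_)
  · exact (hr.comp (f := fun p : Pos d × Vel d => (p.1, -(p.2 : Pos d))) (by fun_prop)).measurable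
  · exact (hr.comp (f := fun p : Pos d × Vel d => (p.1, -(w : Pos d))) (by fun_prop)).measurable

lemma lintegral_velKernel {U : Pos d → ℝ} (hU : ContDiff ℝ 1 U) (lref : ℝ) (x : Pos d)
    (F : Vel d → ℝ≥0∞) :
    ∫⁻ w, F w ∂(velKernel U lref x) = ∑ w, ENNReal.ofReal (velProb U lref x w) * F w := by
  have hm : Measurable (Function.uncurry
      (fun (x : Pos d) (w : Vel d) => ENNReal.ofReal (velProb U lref x w))) :=
    ENNReal.measurable_ofReal.comp (measurable_velProb hU lref)
  rw [velKernel, Kernel.lintegral_withDensity _ hm _ (measurable_of_finite F), Kernel.const_apply,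
    lintegral_count, tsum_fintype]

lemma lintegral_holdKernel {U : Pos d → ℝ} (hU : ContDiff ℝ 1 U) (lref : ℝ) (z : State d)
    {F : ℝ → ℝ≥0∞} (hF : Measurable F) :
    ∫⁻ r, F r ∂(holdKernel U lref z) =
      ∫⁻ r in Set.Ioi (0 : ℝ), ENNReal.ofReal (holdDensity U lref z r) * F r := by
  have hm : Measurable (Function.uncurry
      (fun (z : State d) t => ENNReal.ofReal (holdDensity U lref z t))) :=
    ENNReal.measurable_ofReal.comp (continuous_holdDensity hU lref).measurable
  rw [holdKernel, Kernel.lintegral_withDensity _ hm _ hF, Kernel.const_apply]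

lemma measurable_flowPos : Measurable (fun p : State d × ℝ => flowPos p.1 p.2) := by
  unfold flowPos
  fun_prop

lemma lintegral_stepKernel {U : Pos d → ℝ} (hU : ContDiff ℝ 1 U) {lref : ℝ} (hl : 0 < lref)
    (m : Mark d) {F : Mark d → ℝ≥0∞} (hF : Measurable F) :
    ∫⁻ y, F y ∂(stepKernel U lref m) =
      ∫⁻ r in Set.Ioi (0 : ℝ), ENNReal.ofReal (holdDensity U lref m.2 r) *
        ∑ w, ENNReal.ofReal (velProb U lref (flowPos m.2 r) w) *
          F (m.1 + r, (flowPos m.2 r, w)) := by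
  have := isMarkovKernel_holdKernel hU hl
  have := isMarkovKernel_velKernel hU hl
  have hG : Measurable fun q : ℝ × Vel d => F (nextMark (m, q)) :=
    hF.comp (measurable_nextMark.comp (by fun_prop))
  unfold stepKernel eventKernel
  rw [Kernel.map_apply _ measurable_nextMark, lintegral_map hF measurable_nextMark,
    Kernel.prod_apply, Kernel.id_apply, Measure.dirac_prod,
    lintegral_map (f := fun a => F (nextMark a)) (hF.comp measurable_nextMark) (by fun_prop),
    Kernel.comap_apply]
  rw [Kernel.lintegral_compProd _ _ _ hG]
  simp only [Kernel.comap_apply, lintegral_velKernel hU]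
  rw [lintegral_holdKernel hU]
  · rfl
  · refine Finset.measurable_sum _ fun w _ => ?_
    have h1 : Measurable fun r : ℝ => velProb U lref (flowPos m.2 r) w :=
      (measurable_velProb hU lref).comp (f := fun r : ℝ => (flowPos m.2 r, w))
        ((measurable_flowPos.comp (f := fun r : ℝ => (m.2, r)) (by fun_prop)).prodMk (by fun_prop))
    exact (h1.ennreal_ofReal).mul (hG.comp (f := fun r : ℝ => (r, w)) (by fun_prop))

lemma isMarkovKernel_pastKernel {U : Pos d → ℝ} (hU : ContDiff ℝ 1 U) {lref : ℝ} (hl : 0 < lref)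
    (n : ℕ) : IsMarkovKernel (pastKernel U lref n) :=
  haveI : IsMarkovKernel (stepKernel U lref) := isMarkovKernel_stepKernel hU hl
  Kernel.IsMarkovKernel.comap _ (measurable_pi_apply _)

lemma isMarkovKernel_skeletonLaw {U : Pos d → ℝ} (hU : ContDiff ℝ 1 U) {lref : ℝ} (hl : 0 < lref) :
    IsMarkovKernel (skeletonLaw hU hl) := by
  have := isMarkovKernel_pastKernel hU hl
  have : IsMarkovKernel (Kernel.traj (X := fun _ => Mark d) (pastKernel U lref) 0) :=
    inferInstance
  unfold skeletonLaw
  exact Kernel.IsMarkovKernel.comap _ _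

/-- The Markov property of the skeleton, for two successive entries. -/
lemma lintegral_skeletonLaw_succ {U : Pos d → ℝ} (hU : ContDiff ℝ 1 U) {lref : ℝ} (hl : 0 < lref)
    (z : State d) (n : ℕ) {F : Mark d × Mark d → ℝ≥0∞} (hF : Measurable F) :
    ∫⁻ ω, F (ω n, ω (n + 1)) ∂(skeletonLaw hU hl z) =
      ∫⁻ ω, ∫⁻ y, F (ω n, y) ∂(stepKernel U lref (ω n)) ∂(skeletonLaw hU hl z) := by
  have := isMarkovKernel_stepKernel hU hl
  have := isMarkovKernel_pastKernel hU hl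
  unfold skeletonLaw
  rw [Kernel.comap_apply]
  set x₀ : (i : Finset.Iic 0) → Mark d := fun _ => ((0 : ℝ), z)
  -- The past up to n together with the next entry has the composition product of the marginal and
  -- `pastKernel` as its law; the integrand `G` only reads the last entry of the past.
  have key := Kernel.partialTraj_compProd_eq_map_traj (X := fun _ => Mark d)
    (κ := pastKernel U lref) (Nat.zero_le n) (x₀ := x₀)
  let G : ((i : Finset.Iic n) → Mark d) × Mark d → ℝ≥0∞ :=
    fun p => F (p.1 ⟨n, Finset.mem_Iic.2 le_rfl⟩, p.2)
  have hG : Measurable G := hF.comp (by fun_prop)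
  have h1 : ∫⁻ p, G p ∂((Kernel.traj (X := fun _ => Mark d) (pastKernel U lref) 0 x₀).map
      (fun x => (Preorder.frestrictLe n x, x (n + 1)))) =
      ∫⁻ ω, F (ω n, ω (n + 1)) ∂(Kernel.traj (X := fun _ => Mark d) (pastKernel U lref) 0 x₀) := by
    rw [lintegral_map hG (by fun_prop)]
    rfl
  rw [← h1, ← key, Measure.lintegral_compProd hG, ← Kernel.traj_map_frestrictLe_apply,
    lintegral_map (Measurable.lintegral_kernel_prod_right' hG) (by fun_prop)]
  rfl

lemma ae_skeletonLaw_zero {U : Pos d → ℝ} (hU : ContDiff ℝ 1 U) {lref : ℝ} (hl : 0 < lref)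
    (z : State d) : ∀ᵐ ω ∂(skeletonLaw hU hl z), ω 0 = ((0 : ℝ), z) := by
  have := isMarkovKernel_pastKernel hU hl
  unfold skeletonLaw
  rw [Kernel.comap_apply]
  set x₀ : (i : Finset.Iic 0) → Mark d := fun _ => ((0 : ℝ), z)
  have key := Kernel.traj_map_frestrictLe_apply (X := fun _ => Mark d)
    (κ := pastKernel U lref) 0 0 x₀
  rw [Kernel.partialTraj_self, Kernel.id_apply] at key
  have h : ∀ᵐ p ∂((Kernel.traj (X := fun _ => Mark d) (pastKernel U lref) 0 x₀).map
      (Preorder.frestrictLe 0)), p = x₀ := by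
    rw [key]
    exact (ae_dirac_iff (measurableSet_singleton x₀)).2 rfl
  filter_upwards [ae_of_ae_map (by fun_prop) h] with ω hω
  exact congrFun hω ⟨0, Finset.mem_Iic.2 le_rfl⟩

lemma norm_vel_le_one (v : Vel d) : ‖(v : Pos d)‖ ≤ 1 := by
  obtain ⟨v, hv⟩ := v
  simp only [velocities, Finset.mem_insert, Finset.mem_union, Finset.mem_image, Finset.mem_univ,
    true_and] at hv
  rcases hv with rfl | ⟨i, rfl⟩ | ⟨i, rfl⟩ <;> simp

lemma sum_ofReal_velProb {U : Pos d → ℝ} (hU : ContDiff ℝ 1 U) {lref : ℝ} (hl : 0 < lref)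
    (x : Pos d) : ∑ w, ENNReal.ofReal (velProb U lref x w) = 1 := by
  have := isMarkovKernel_velKernel hU hl
  have h := lintegral_velKernel hU lref x (fun _ => 1)
  simpa using h.symm

lemma ae_stepKernel {U : Pos d → ℝ} (hU : ContDiff ℝ 1 U) {lref : ℝ} (hl : 0 < lref)
    (m : Mark d) {p : Mark d → Prop} (hp : MeasurableSet {y | p y})
    (h : ∀ r : ℝ, 0 < r → ∀ w, p (m.1 + r, (flowPos m.2 r, w))) :
    ∀ᵐ y ∂(stepKernel U lref m), p y := by
  have hp' : MeasurableSet {y | ¬ p y} := hp.compl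
  rw [ae_iff, ← lintegral_indicator_one hp',
    lintegral_stepKernel hU hl m (measurable_one.indicator hp')]
  refine (setLIntegral_congr_fun measurableSet_Ioi (g := fun _ => 0) fun r hr => ?_).trans (by simp)
  have h0 : ∀ w, ({y | ¬ p y}.indicator 1 (m.1 + r, (flowPos m.2 r, w)) : ℝ≥0∞) = 0 := fun w =>
    Set.indicator_of_notMem (not_not.2 (h r hr w)) _
  simp [h0]

lemma ae_skeletonLaw_succ {U : Pos d → ℝ} (hU : ContDiff ℝ 1 U) {lref : ℝ} (hl : 0 < lref)
    (z : State d) (n : ℕ) {p : Mark d × Mark d → Prop} (hp : MeasurableSet {y | p y})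
    (h : ∀ m : Mark d, ∀ r : ℝ, 0 < r → ∀ w, p (m, (m.1 + r, (flowPos m.2 r, w)))) :
    ∀ᵐ ω ∂(skeletonLaw hU hl z), p (ω n, ω (n + 1)) := by
  have hp' : MeasurableSet {y | ¬ p y} := hp.compl
  have hm : Measurable fun ω : ℕ → Mark d => (ω n, ω (n + 1)) := by fun_prop
  have key := lintegral_skeletonLaw_succ hU hl z n (F := {y | ¬ p y}.indicator 1)
    (measurable_one.indicator hp')
  have e : ∫⁻ ω, ({y | ¬ p y}.indicator 1 (ω n, ω (n + 1)) : ℝ≥0∞) ∂(skeletonLaw hU hl z) =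
      skeletonLaw hU hl z {ω | ¬ p (ω n, ω (n + 1))} :=
    lintegral_indicator_one (hm hp')
  rw [ae_iff, ← e, key]
  refine (lintegral_congr fun ω => ?_).trans lintegral_zero
  have hs : MeasurableSet {y | p (ω n, y)} := hp.preimage (by fun_prop)
  have := ae_stepKernel hU hl (ω n) hs (h (ω n))
  rw [← lintegral_zero (μ := stepKernel U lref (ω n))]
  refine lintegral_congr_ae ?_
  filter_upwards [this] with y hy
  exact Set.indicator_of_notMem (not_not.2 hy) _

lemma ae_skeletonLaw_increments {U : Pos d → ℝ} (hU : ContDiff ℝ 1 U) {lref : ℝ} (hl : 0 < lref)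
    (z : State d) : ∀ᵐ ω ∂(skeletonLaw hU hl z), ∀ n,
      (ω n).1 < (ω (n + 1)).1 ∧ ‖(ω (n + 1)).2.1 - (ω n).2.1‖ ≤ (ω (n + 1)).1 - (ω n).1 := by
  rw [ae_all_iff]
  intro n
  refine ae_skeletonLaw_succ hU hl z n
    (p := fun q => q.1.1 < q.2.1 ∧ ‖q.2.2.1 - q.1.2.1‖ ≤ q.2.1 - q.1.1) ?_ ?_
  · refine MeasurableSet.inter
      (measurableSet_lt (f := fun q : Mark d × Mark d => q.1.1) (g := fun q => q.2.1)
        (by fun_prop) (by fun_prop))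
      (measurableSet_le (f := fun q : Mark d × Mark d => ‖q.2.2.1 - q.1.2.1‖)
        (g := fun q => q.2.1 - q.1.1) (by fun_prop) (by fun_prop))
  · intro m r hr w
    refine ⟨by simpa using hr, ?_⟩
    simp only [flowPos, add_sub_cancel_left, norm_smul, Real.norm_of_nonneg hr.le]
    exact mul_le_of_le_one_right hr.le (norm_vel_le_one _)

/-- The skeleton starts at the initial state, its event times increase strictly, and the positions
move at speed at most one. -/
lemma ae_skeletonLaw_regular {U : Pos d → ℝ} (hU : ContDiff ℝ 1 U) {lref : ℝ} (hl : 0 < lref)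
    (z : State d) : ∀ᵐ ω ∂(skeletonLaw hU hl z), ω 0 = ((0 : ℝ), z) ∧
      StrictMono (fun n => (ω n).1) ∧ ∀ n, ‖(ω n).2.1 - z.1‖ ≤ (ω n).1 := by
  filter_upwards [ae_skeletonLaw_zero hU hl z, ae_skeletonLaw_increments hU hl z] with ω h0 h
  refine ⟨h0, strictMono_nat_of_lt_succ fun n => (h n).1, fun n => ?_⟩
  induction n with
  | zero => simp [h0]
  | succ n ih =>
    calc ‖(ω (n + 1)).2.1 - z.1‖
        = ‖((ω (n + 1)).2.1 - (ω n).2.1) + ((ω n).2.1 - z.1)‖ := by congr 1; abel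
      _ ≤ _ := norm_add_le _ _
      _ ≤ _ := by linarith [(h n).2]

/-! ### Non-explosion -/

lemma exists_rate_le {U : Pos d → ℝ} (hU : ContDiff ℝ 1 U) (lref : ℝ) (x : Pos d) (T : ℝ) :
    ∃ M : ℝ, 0 < M ∧ ∀ y, ‖y - x‖ ≤ T → ∀ v : Vel d, rate U lref y v ≤ M := by
  have hc : IsCompact (Metric.closedBall x T ×ˢ Metric.closedBall (0 : Pos d) 1) :=
    (isCompact_closedBall x T).prod (isCompact_closedBall _ _)
  obtain ⟨M, hM⟩ := hc.bddAbove_image (continuous_rate hU lref).continuousOn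
  refine ⟨max M 1, by positivity, fun y hy v => le_max_of_le_left (hM ⟨(y, v), ⟨?_, ?_⟩, rfl⟩)⟩
  · simpa [dist_eq_norm] using hy
  · simpa using norm_vel_le_one v

lemma rate_add (U : Pos d → ℝ) (lref a : ℝ) (x v : Pos d) :
    rate U (lref + a) x v = rate U lref x v + a := by
  unfold rate; ring

lemma continuous_rate_line {U : Pos d → ℝ} (hU : ContDiff ℝ 1 U) (lref : ℝ) (x v w : Pos d) :
    Continuous fun s : ℝ => rate U lref (x + s • v) w :=
  (continuous_rate hU lref).comp (f := fun s : ℝ => (x + s • v, w)) (by fun_prop)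

/-- Raising `lref` by one superposes an independent clock of rate one. The discount factor `exp
(-r)` is thereby absorbed into another holding density, whose total mass is known to be one. -/
lemma holdDensity_add_one {U : Pos d → ℝ} (hU : ContDiff ℝ 1 U) (lref : ℝ) (z : State d) (r : ℝ) :
    holdDensity U (lref + 1) z r = (rate U lref (z.1 + r • (z.2 : Pos d)) z.2 + 1) *
      (Real.exp (-∫ s in (0 : ℝ)..r, rate U lref (z.1 + s • (z.2 : Pos d)) z.2) *
        Real.exp (-r)) := by
  simp only [holdDensity, rate_add]
  rw [intervalIntegral.integral_add ((continuous_rate_line hU lref _ _ _).intervalIntegrable _ _)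
    intervalIntegrable_const, ← Real.exp_add]
  simp [add_comm]

/-- The function `1_{s ≤ T} exp(-s)` of the time of an event. -/
noncomputable def discount (T : ℝ) (s : ℝ) : ℝ≥0∞ :=
  (Set.Iic T).indicator (fun s => ENNReal.ofReal (Real.exp (-s))) s

lemma measurable_discount (T : ℝ) : Measurable (discount T) :=
  Measurable.indicator (by fun_prop) measurableSet_Iic

lemma discount_of_le {T s : ℝ} (h : s ≤ T) : discount T s = ENNReal.ofReal (Real.exp (-s)) :=
  Set.indicator_of_mem (Set.mem_Iic.2 h) _

lemma discount_of_lt {T s : ℝ} (h : T < s) : discount T s = 0 :=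
  Set.indicator_of_notMem (fun h' => not_le.2 h (Set.mem_Iic.1 h')) _

/-- If the next event comes before T, it happens within distance T of `x`, where the rate l
satisfies l ≤ M, equivalently l ≤ M/(M+1) · (l+1). So the discounted density is at most M/(M+1)
times the holding density for `lref + 1`, which integrates to one. -/
lemma lintegral_discount_stepKernel_le {U : Pos d → ℝ} (hU : ContDiff ℝ 1 U) {lref : ℝ}
    (hl : 0 < lref) {x : Pos d} {T M : ℝ} (hM0 : 0 < M)
    (hM : ∀ y, ‖y - x‖ ≤ T → ∀ v : Vel d, rate U lref y v ≤ M) (m : Mark d)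
    (hm : ‖m.2.1 - x‖ ≤ m.1) :
    ∫⁻ y, discount T y.1 ∂(stepKernel U lref m) ≤
      ENNReal.ofReal (M / (M + 1)) * discount T m.1 := by
  have hmeas : Measurable fun y : Mark d => discount T y.1 :=
    (measurable_discount T).comp measurable_fst
  rw [lintegral_stepKernel hU hl m hmeas]
  simp only [← Finset.sum_mul, sum_ofReal_velProb hU hl, one_mul]
  by_cases hT : m.1 ≤ T
  · have hd : discount T m.1 = ENNReal.ofReal (Real.exp (-m.1)) := discount_of_le hT
    have hc : 0 ≤ M / (M + 1) := by positivity
    calc ∫⁻ r in Set.Ioi (0 : ℝ), ENNReal.ofReal (holdDensity U lref m.2 r) * discount T (m.1 + r)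
        ≤ ∫⁻ r in Set.Ioi (0 : ℝ), (ENNReal.ofReal (M / (M + 1)) * discount T m.1) *
            ENNReal.ofReal (holdDensity U (lref + 1) m.2 r) := by
          refine setLIntegral_mono' measurableSet_Ioi fun r hr => ?_
          rw [Set.mem_Ioi] at hr
          by_cases hr' : m.1 + r ≤ T
          · have hd' : discount T (m.1 + r) = ENNReal.ofReal (Real.exp (-(m.1 + r))) :=
              discount_of_le hr'
            have hpos : 0 ≤ rate U lref (m.2.1 + r • (m.2.2 : Pos d)) m.2.2 :=
              hl.le.trans (rate_ge _ _ _ _)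
            have hh : 0 ≤ holdDensity U lref m.2 r := mul_nonneg hpos (Real.exp_pos _).le
            rw [hd, hd', ← ENNReal.ofReal_mul hc, ← ENNReal.ofReal_mul hh,
              ← ENNReal.ofReal_mul (by positivity), holdDensity_add_one hU]
            refine ENNReal.ofReal_le_ofReal ?_
            have hle : rate U lref (m.2.1 + r • (m.2.2 : Pos d)) m.2.2 ≤ M := by
              refine hM _ ?_ _
              calc ‖m.2.1 + r • (m.2.2 : Pos d) - x‖
                  = ‖(m.2.1 - x) + r • (m.2.2 : Pos d)‖ := by congr 1; abel
                _ ≤ ‖m.2.1 - x‖ + ‖r • (m.2.2 : Pos d)‖ := norm_add_le _ _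
                _ ≤ m.1 + r := by
                  refine add_le_add hm ?_
                  rw [norm_smul, Real.norm_of_nonneg hr.le]
                  exact mul_le_of_le_one_right hr.le (norm_vel_le_one _)
                _ ≤ T := hr'
            rw [holdDensity, neg_add, Real.exp_add]
            set l := rate U lref (m.2.1 + r • (m.2.2 : Pos d)) m.2.2
            have hl' : l ≤ M / (M + 1) * (l + 1) := by
              rw [div_mul_eq_mul_div, le_div_iff₀ (by positivity)]
              nlinarith
            set E := Real.exp (-∫ s in (0 : ℝ)..r, rate U lref (m.2.1 + s • (m.2.2 : Pos d)) m.2.2)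
            have hE : 0 < E := Real.exp_pos _
            calc l * E * (Real.exp (-m.1) * Real.exp (-r))
                = l * (E * (Real.exp (-m.1) * Real.exp (-r))) := by ring
              _ ≤ (M / (M + 1) * (l + 1)) * (E * (Real.exp (-m.1) * Real.exp (-r))) := by gcongr
              _ = _ := by ring
          · have hd' : discount T (m.1 + r) = 0 := discount_of_lt (not_le.1 hr')
            simp [hd']
      _ = _ := by
          have hmh : Measurable fun r => ENNReal.ofReal (holdDensity U (lref + 1) m.2 r) :=
            ENNReal.measurable_ofReal.comp ((continuous_holdDensity hU (lref + 1)).comp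
              (f := fun r : ℝ => (m.2, r)) (by fun_prop)).measurable
          rw [lintegral_const_mul _ hmh,
            lintegral_holdDensity hU (by linarith : 0 < lref + 1), mul_one]
  · have hd : discount T m.1 = 0 := discount_of_lt (not_le.1 hT)
    rw [hd, mul_zero]
    refine (setLIntegral_congr_fun measurableSet_Ioi (g := fun _ => 0) fun r hr => ?_).le.trans
      (by simp)
    have hd' : discount T (m.1 + r) = 0 :=
      discount_of_lt (by linarith [Set.mem_Ioi.1 hr, not_le.1 hT])
    simp [hd']

lemma lintegral_discount_skeletonLaw_le {U : Pos d → ℝ} (hU : ContDiff ℝ 1 U) {lref : ℝ}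
    (hl : 0 < lref) (z : State d) {T M : ℝ} (hM0 : 0 < M)
    (hM : ∀ y, ‖y - z.1‖ ≤ T → ∀ v : Vel d, rate U lref y v ≤ M) (n : ℕ) :
    ∫⁻ ω, discount T (ω n).1 ∂(skeletonLaw hU hl z) ≤ ENNReal.ofReal (M / (M + 1)) ^ n := by
  have := isMarkovKernel_skeletonLaw hU hl
  induction n with
  | zero =>
    rw [pow_zero]
    calc ∫⁻ ω, discount T (ω 0).1 ∂(skeletonLaw hU hl z)
        ≤ ∫⁻ _, 1 ∂(skeletonLaw hU hl z) := by
          refine lintegral_mono_ae ?_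
          filter_upwards [ae_skeletonLaw_zero hU hl z] with ω h0
          rw [h0]
          rcases le_or_gt 0 T with h | h
          · simp [discount_of_le h]
          · simp [discount_of_lt h]
      _ = 1 := by simp
  | succ n ih =>
    rw [lintegral_skeletonLaw_succ hU hl z n (F := fun q => discount T q.2.1)
      ((measurable_discount T).comp (by fun_prop))]
    calc _ ≤ ∫⁻ ω, ENNReal.ofReal (M / (M + 1)) * discount T (ω n).1 ∂(skeletonLaw hU hl z) := by
          refine lintegral_mono_ae ?_
          filter_upwards [ae_skeletonLaw_regular hU hl z] with ω h
          exact lintegral_discount_stepKernel_le hU hl hM0 hM (ω n) (h.2.2 n)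
      _ = ENNReal.ofReal (M / (M + 1)) * ∫⁻ ω, discount T (ω n).1 ∂(skeletonLaw hU hl z) :=
          lintegral_const_mul _ ((measurable_discount T).comp (by fun_prop))
      _ ≤ _ := by rw [pow_succ']; gcongr

/-- On the event that every event time is at most T, the discount of each is at least e^{-T}; the
probability of this event is therefore at most e^T (M/(M+1))^n for all n. -/
lemma ae_skeletonLaw_exists_lt {U : Pos d → ℝ} (hU : ContDiff ℝ 1 U) {lref : ℝ} (hl : 0 < lref)
    (z : State d) (T : ℝ) : ∀ᵐ ω ∂(skeletonLaw hU hl z), ∃ n, T < (ω n).1 := by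
  obtain ⟨M, hM0, hM⟩ := exists_rate_le hU lref z.1 T
  have hlt : ENNReal.ofReal (M / (M + 1)) < 1 := by
    rw [ENNReal.ofReal_lt_one, div_lt_one (by positivity)]
    linarith
  rw [ae_iff]
  set A := {ω : ℕ → Mark d | ¬ ∃ n, T < (ω n).1}
  have hA : MeasurableSet A := by
    have : A = ⋂ n, {ω : ℕ → Mark d | (ω n).1 ≤ T} := by ext; simp [A]
    rw [this]
    exact MeasurableSet.iInter fun n => measurableSet_le (by fun_prop) (by fun_prop)
  have hle : ∀ n : ℕ, ENNReal.ofReal (Real.exp (-T)) * skeletonLaw hU hl z A ≤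
      ENNReal.ofReal (M / (M + 1)) ^ n := by
    intro n
    refine le_trans ?_ (lintegral_discount_skeletonLaw_le hU hl z hM0 hM n)
    rw [← lintegral_indicator_const hA]
    refine lintegral_mono fun ω => ?_
    by_cases hω : ω ∈ A
    swap
    · simp [hω]
    rw [Set.indicator_of_mem hω]
    have hω' : (ω n).1 ≤ T := not_lt.1 fun h => hω ⟨n, h⟩
    rw [discount_of_le hω']
    exact ENNReal.ofReal_le_ofReal (Real.exp_le_exp.2 (neg_le_neg hω'))
  have h0 := ge_of_tendsto' (ENNReal.tendsto_pow_atTop_nhds_zero_of_lt_one hlt) hle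
  rcases mul_eq_zero.1 (nonpos_iff_eq_zero.1 h0) with h | h
  · exact absurd (ENNReal.ofReal_eq_zero.1 h) (not_le.2 (Real.exp_pos _))
  · exact h

/-- The process does not explode: the event times increase strictly to infinity. -/
lemma ae_skeletonLaw_nonexplosive {U : Pos d → ℝ} (hU : ContDiff ℝ 1 U) {lref : ℝ}
    (hl : 0 < lref) (z : State d) : ∀ᵐ ω ∂(skeletonLaw hU hl z),
      StrictMono (fun n => (ω n).1) ∧ Tendsto (fun n => (ω n).1) atTop atTop := by
  filter_upwards [ae_skeletonLaw_regular hU hl z,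
    ae_all_iff.2 fun k : ℕ => ae_skeletonLaw_exists_lt hU hl z k] with ω h hk
  refine ⟨h.2.1, tendsto_atTop_atTop_of_monotone h.2.1.monotone fun b => ?_⟩
  obtain ⟨k, hbk⟩ := exists_nat_ge b
  obtain ⟨n, hn⟩ := hk k
  exact ⟨n, hbk.trans hn.le⟩

/-! ### Velocity reversal and the expansion in the number of events -/

lemma neg_mem_velocities {v : Pos d} (hv : v ∈ velocities d) : -v ∈ velocities d := by
  simp only [velocities, Finset.mem_insert, Finset.mem_union, Finset.mem_image, Finset.mem_univ,
    true_and] at hv ⊢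
  rcases hv with rfl | ⟨i, rfl⟩ | ⟨i, rfl⟩
  · simp
  · exact Or.inr (Or.inr ⟨i, rfl⟩)
  · exact Or.inr (Or.inl ⟨i, by simp⟩)

/-- The opposite velocity. -/
def oppVel (v : Vel d) : Vel d := ⟨-v, neg_mem_velocities v.2⟩

@[simp] lemma coe_oppVel (v : Vel d) : (oppVel v : Pos d) = -v := rfl

@[simp] lemma oppVel_oppVel (v : Vel d) : oppVel (oppVel v) = v := by ext1; simp

lemma oppVel_involutive : Function.Involutive (oppVel (d := d)) := oppVel_oppVel

lemma sum_oppVel {M : Type*} [AddCommMonoid M] (F : Vel d → M) :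
    ∑ v, F (oppVel v) = ∑ v, F v :=
  Equiv.sum_comp oppVel_involutive.toPerm F

/-- Precomposition with the reversal of the velocity. -/
def flip (f : State d → ℝ≥0∞) (z : State d) : ℝ≥0∞ := f (z.1, oppVel z.2)

@[simp] lemma flip_flip (f : State d → ℝ≥0∞) : flip (flip f) = f := by
  ext z; simp [flip]

/-- The probability that no event occurs before time `r`, extended by `0` to negative times. -/
noncomputable def survival (U : Pos d → ℝ) (lref : ℝ) (z : State d) (r : ℝ) : ℝ≥0∞ :=
  if 0 ≤ r then
    ENNReal.ofReal (Real.exp (-∫ s in (0 : ℝ)..r, rate U lref (z.1 + s • (z.2 : Pos d)) z.2))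
  else 0

/-- The part of the transition at time `r` without events. -/
noncomputable def transport (U : Pos d → ℝ) (lref : ℝ) (r : ℝ) (φ : State d → ℝ≥0∞)
    (z : State d) : ℝ≥0∞ :=
  survival U lref z r * φ (flowPos z r, z.2)

/-- The jump part of the generator. -/
noncomputable def jump (U : Pos d → ℝ) (lref : ℝ) (φ : State d → ℝ≥0∞) (z : State d) : ℝ≥0∞ :=
  ENNReal.ofReal (rate U lref z.1 z.2) *
    ∑ w, ENNReal.ofReal (velProb U lref z.1 w) * φ (z.1, w)

/-- The part of the transition at time `t` with exactly `n` events. -/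
noncomputable def eventTerm (U : Pos d → ℝ) (lref : ℝ) (g : State d → ℝ≥0∞) :
    ℕ → ℝ → State d → ℝ≥0∞
  | 0, t => transport U lref t g
  -- The integral runs over the whole line: `survival` vanishes at negative times, which enforces 0
  -- ≤ r ≤ t, and later changes of the time variable are plain translations or reflections of ℝ.
  | n + 1, t => fun z => ∫⁻ r, transport U lref r (jump U lref (eventTerm U lref g n (t - r))) z

/-- The unnormalised target. -/
noncomputable def refMeasure (U : Pos d → ℝ) : Measure (State d) :=
  ((volume : Measure (Pos d)).withDensity fun x => ENNReal.ofReal (Real.exp (-U x))).prod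
    Measure.count

instance (U : Pos d → ℝ) : SFinite (refMeasure U) := by
  unfold refMeasure; infer_instance

section Measurability

variable {α : Type*} [MeasurableSpace α]

lemma measurable_flip {Φ : α → State d → ℝ≥0∞} (hΦ : Measurable fun p : α × State d => Φ p.1 p.2) :
    Measurable fun p : α × State d => flip (Φ p.1) p.2 :=
  hΦ.comp (f := fun p : α × State d => (p.1, (p.2.1, oppVel p.2.2)))
    (measurable_fst.prodMk ((by fun_prop : Measurable fun p : α × State d => p.2.1).prodMk
      ((measurable_of_finite oppVel).comp (by fun_prop))))

lemma measurable_survival {U : Pos d → ℝ} (hU : ContDiff ℝ 1 U) (lref : ℝ) :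
    Measurable fun p : State d × ℝ => survival U lref p.1 p.2 := by
  have hr := continuous_rate hU lref
  have h2 : Continuous (fun p : State d × ℝ =>
      ∫ s in (0 : ℝ)..p.2, rate U lref (p.1.1 + s • (p.1.2 : Pos d)) p.1.2) := by
    apply intervalIntegral.continuous_parametric_intervalIntegral_of_continuous
    · exact hr.comp (f := fun q : (State d × ℝ) × ℝ =>
        (q.1.1.1 + q.2 • (q.1.1.2 : Pos d), (q.1.1.2 : Pos d))) (by fun_prop)
    · fun_prop
  unfold survival
  refine Measurable.ite (measurableSet_le measurable_const measurable_snd) ?_ measurable_const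
  exact (Real.continuous_exp.comp h2.neg).measurable.ennreal_ofReal

lemma measurable_transport {U : Pos d → ℝ} (hU : ContDiff ℝ 1 U) (lref : ℝ) {r : α → ℝ}
    (hr : Measurable r) {Φ : α → State d → ℝ≥0∞}
    (hΦ : Measurable fun p : α × State d => Φ p.1 p.2) :
    Measurable fun p : α × State d => transport U lref (r p.1) (Φ p.1) p.2 := by
  unfold transport
  refine ((measurable_survival hU lref).comp (f := fun p : α × State d => (p.2, r p.1))
    (by fun_prop)).mul ?_
  refine hΦ.comp (f := fun p : α × State d => (p.1, (flowPos p.2 (r p.1), p.2.2))) ?_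
  have := measurable_flowPos.comp (f := fun p : α × State d => (p.2, r p.1)) (by fun_prop)
  exact measurable_fst.prodMk (this.prodMk (by fun_prop))

lemma measurable_jump {U : Pos d → ℝ} (hU : ContDiff ℝ 1 U) (lref : ℝ) {Φ : α → State d → ℝ≥0∞}
    (hΦ : Measurable fun p : α × State d => Φ p.1 p.2) :
    Measurable fun p : α × State d => jump U lref (Φ p.1) p.2 := by
  unfold jump
  refine Measurable.mul (Measurable.ennreal_ofReal ?_) (Finset.measurable_sum _ fun w _ => ?_)
  · exact (continuous_rate hU lref).measurable.comp
      (f := fun p : α × State d => (p.2.1, (p.2.2 : Pos d))) (by fun_prop)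
  · refine Measurable.mul (Measurable.ennreal_ofReal ?_) ?_
    · exact (measurable_velProb hU lref).comp (f := fun p : α × State d => (p.2.1, w))
        (by fun_prop)
    · exact hΦ.comp (f := fun p : α × State d => (p.1, (p.2.1, w))) (by fun_prop)

lemma measurable_eventTerm {U : Pos d → ℝ} (hU : ContDiff ℝ 1 U) (lref : ℝ)
    {g : State d → ℝ≥0∞} (hg : Measurable g) (n : ℕ) :
    Measurable fun p : ℝ × State d => eventTerm U lref g n p.1 p.2 := by
  induction n with
  | zero =>
    exact measurable_transport hU lref (r := id) measurable_id (Φ := fun _ => g)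
      (hg.comp measurable_snd)
  | succ n ih =>
    have h1 := measurable_jump hU lref ih
    have h2 : Measurable fun p : (ℝ × ℝ) × State d =>
        jump U lref (eventTerm U lref g n (p.1.1 - p.1.2)) p.2 :=
      h1.comp (f := fun p : (ℝ × ℝ) × State d => (p.1.1 - p.1.2, p.2)) (by fun_prop)
    have h3 := measurable_transport hU lref (r := fun q : ℝ × ℝ => q.2) measurable_snd
      (Φ := fun q => jump U lref (eventTerm U lref g n (q.1 - q.2))) h2
    exact Measurable.lintegral_prod_right' (f := fun p : (ℝ × State d) × ℝ =>
      transport U lref p.2 (jump U lref (eventTerm U lref g n (p.1.1 - p.2))) p.1.2)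
      (h3.comp (f := fun p : (ℝ × State d) × ℝ => ((p.1.1, p.2), p.1.2)) (by fun_prop))

lemma measurable_flip_const {f : State d → ℝ≥0∞} (hf : Measurable f) : Measurable (flip f) :=
  (measurable_flip (Φ := fun _ : Unit => f) (hf.comp measurable_snd)).comp
    (f := fun z : State d => ((), z)) (by fun_prop)

lemma measurable_transport_const {U : Pos d → ℝ} (hU : ContDiff ℝ 1 U) (lref r : ℝ)
    {f : State d → ℝ≥0∞} (hf : Measurable f) : Measurable (transport U lref r f) :=
  (measurable_transport hU lref (r := fun _ => r) measurable_const (Φ := fun _ : Unit => f)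
    (hf.comp measurable_snd)).comp (f := fun z : State d => ((), z)) (by fun_prop)

lemma measurable_jump_const {U : Pos d → ℝ} (hU : ContDiff ℝ 1 U) (lref : ℝ)
    {f : State d → ℝ≥0∞} (hf : Measurable f) : Measurable (jump U lref f) :=
  (measurable_jump hU lref (Φ := fun _ : Unit => f) (hf.comp measurable_snd)).comp
    (f := fun z : State d => ((), z)) (by fun_prop)

end Measurability

/-! ### Adjoints of flights and jumps -/

lemma lintegral_refMeasure {U : Pos d → ℝ} (hU : ContDiff ℝ 1 U) {F : State d → ℝ≥0∞}
    (hF : Measurable F) :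
    ∫⁻ z, F z ∂(refMeasure U) = ∑ v, ∫⁻ x, ENNReal.ofReal (Real.exp (-U x)) * F (x, v) := by
  have hc := hU.continuous
  rw [refMeasure, lintegral_prod_symm' _ hF, lintegral_count, tsum_fintype]
  refine Finset.sum_congr rfl fun v _ => ?_
  rw [lintegral_withDensity_eq_lintegral_mul _ (by fun_prop)
    (g := fun x => F (x, v)) (hF.comp (by fun_prop))]
  rfl

/-- max(a, 0) - max(-a, 0) = a, and `lref` cancels. This identity ties the rates to the potential in
both invariance statements. -/
lemma rate_sub_rate_neg (U : Pos d → ℝ) (lref : ℝ) (x v : Pos d) :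
    rate U lref x v - rate U lref x (-v) = inner ℝ v (gradient U x) := by
  unfold rate
  rw [inner_neg_left]
  rcases le_total (inner ℝ v (gradient U x)) 0 with h | h
  · rw [max_eq_right h, max_eq_left (by linarith)]; ring
  · rw [max_eq_left h, max_eq_right (by linarith)]; ring

/-- Along a segment, the difference between the forward and the backward event intensities is the
increment of the potential. -/
lemma potential_add_integral_rate {U : Pos d → ℝ} (hU : ContDiff ℝ 1 U) (lref : ℝ)
    (x v : Pos d) (r : ℝ) :
    U x + ∫ s in (0 : ℝ)..r, rate U lref (x + s • v) v =
      U (x + r • v) + ∫ s in (0 : ℝ)..r, rate U lref (x + r • v + s • (-v)) (-v) := by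
  have hder : ∀ s : ℝ, HasDerivAt (fun s : ℝ => U (x + s • v))
      (rate U lref (x + s • v) v - rate U lref (x + s • v) (-v)) s := by
    intro s
    have h1 : HasDerivAt (fun s : ℝ => x + s • v) v s := by
      simpa using ((hasDerivAt_id s).smul_const v).const_add x
    have h2 := ((hU.differentiable (by norm_num)) (x + s • v)).hasGradientAt.hasFDerivAt
    refine (h2.comp_hasDerivAt s h1).congr_deriv ?_
    rw [rate_sub_rate_neg, InnerProductSpace.toDual_apply_apply, real_inner_comm]
  have hc1 := continuous_rate_line hU lref x v v
  have hc2 := continuous_rate_line hU lref x v (-v)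
  have h := intervalIntegral.integral_eq_sub_of_hasDerivAt (a := 0) (b := r)
    (fun s _ => hder s) ((hc1.sub hc2).intervalIntegrable _ _)
  rw [intervalIntegral.integral_sub (hc1.intervalIntegrable _ _) (hc2.intervalIntegrable _ _)] at h
  -- The substitution s ↦ r - s runs through the same segment backwards.
  have h3 : ∫ s in (0 : ℝ)..r, rate U lref (x + r • v + s • (-v)) (-v) =
      ∫ s in (0 : ℝ)..r, rate U lref (x + s • v) (-v) := by
    have := intervalIntegral.integral_comp_sub_left (a := 0) (b := r)
      (fun s => rate U lref (x + s • v) (-v)) r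
    simp only [sub_self, sub_zero] at this
    rw [← this]
    refine intervalIntegral.integral_congr fun s _ => ?_
    simp only [sub_smul, smul_neg]
    congr 1
    abel
  rw [h3]
  simp only [zero_smul, add_zero] at h
  linarith

/-- Balance for a flight: the weight of the starting point times the survival probability is the
same for the segment and for its reversal, started at the other end. For r < 0 both sides vanish. -/
lemma exp_mul_survival {U : Pos d → ℝ} (hU : ContDiff ℝ 1 U) (lref : ℝ) (x : Pos d) (v : Vel d)
    (r : ℝ) :
    ENNReal.ofReal (Real.exp (-U x)) * survival U lref (x, v) r =
      ENNReal.ofReal (Real.exp (-U (x + r • (v : Pos d)))) *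
        survival U lref (x + r • (v : Pos d), oppVel v) r := by
  unfold survival
  split_ifs
  · rw [← ENNReal.ofReal_mul (Real.exp_pos _).le, ← ENNReal.ofReal_mul (Real.exp_pos _).le,
      ← Real.exp_add, ← Real.exp_add, ← neg_add, ← neg_add]
    simp only [coe_oppVel]
    rw [potential_add_integral_rate hU]
  · simp

/-- The adjoint of the flow part is its conjugate by the reversal of velocities. -/
lemma lintegral_mul_transport {U : Pos d → ℝ} (hU : ContDiff ℝ 1 U) (lref : ℝ) (r : ℝ)
    {f φ : State d → ℝ≥0∞} (hf : Measurable f) (hφ : Measurable φ) :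
    ∫⁻ z, f z * transport U lref r φ z ∂(refMeasure U) =
      ∫⁻ z, flip (transport U lref r (flip f)) z * φ z ∂(refMeasure U) := by
  have ht := measurable_transport_const hU lref r hφ
  have hft := measurable_flip_const
    (measurable_transport_const hU lref r (measurable_flip_const hf))
  have m1 : Measurable fun z => f z * transport U lref r φ z := hf.mul ht
  have m2 : Measurable fun z => flip (transport U lref r (flip f)) z * φ z := hft.mul hφ
  rw [lintegral_refMeasure hU m1, lintegral_refMeasure hU m2]
  refine Finset.sum_congr rfl fun v _ => ?_
  symm
  -- Translation invariance of Lebesgue measure: the right side is reparametrised by the starting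
  -- point of the flight instead of its end.
  rw [← lintegral_add_right_eq_self _ (r • (v : Pos d))]
  symm
  refine lintegral_congr fun x => ?_
  simp only [transport, flip, flowPos, oppVel_oppVel, coe_oppVel, smul_neg, add_neg_cancel_right]
  calc _ = (ENNReal.ofReal (Real.exp (-U x)) * survival U lref (x, v) r) *
        (f (x, v) * φ (x + r • (v : Pos d), v)) := by ring
    _ = _ := by rw [exp_mul_survival hU]; ring

/-- Both sides are λ(x, v) λ(x, -w) divided by a normaliser that depends on x only. -/
lemma rate_mul_velProb (U : Pos d → ℝ) {lref : ℝ} (hl : 0 < lref) (x : Pos d) (v w : Vel d) :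
    ENNReal.ofReal (rate U lref x v) * ENNReal.ofReal (velProb U lref x w) =
      ENNReal.ofReal (rate U lref x (oppVel w)) * ENNReal.ofReal (velProb U lref x (oppVel v)) := by
  rw [← ENNReal.ofReal_mul (hl.le.trans (rate_ge _ _ _ _)),
    ← ENNReal.ofReal_mul (hl.le.trans (rate_ge _ _ _ _))]
  simp only [velProb, coe_oppVel, neg_neg]
  congr 1
  ring

/-- The adjoint of the jump part is its conjugate by the reversal of velocities. -/
lemma lintegral_mul_jump {U : Pos d → ℝ} (hU : ContDiff ℝ 1 U) {lref : ℝ} (hl : 0 < lref)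
    {f φ : State d → ℝ≥0∞} (hf : Measurable f) (hφ : Measurable φ) :
    ∫⁻ z, f z * jump U lref φ z ∂(refMeasure U) =
      ∫⁻ z, flip (jump U lref (flip f)) z * φ z ∂(refMeasure U) := by
  have hj := measurable_jump_const hU lref hφ
  have hft := measurable_flip_const (measurable_jump_const hU lref (measurable_flip_const hf))
  have he : Measurable fun x : Pos d => ENNReal.ofReal (Real.exp (-U x)) := by
    have := hU.continuous
    fun_prop
  have hs : ∀ (v : Vel d) {F : State d → ℝ≥0∞}, Measurable F →
      Measurable fun x => ENNReal.ofReal (Real.exp (-U x)) * F (x, v) :=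
    fun v F hF => he.mul (hF.comp (by fun_prop))
  have m1 : Measurable fun z => f z * jump U lref φ z := hf.mul hj
  have m2 : Measurable fun z => flip (jump U lref (flip f)) z * φ z := hft.mul hφ
  rw [lintegral_refMeasure hU m1, lintegral_refMeasure hU m2,
    ← lintegral_finsetSum _ fun v _ => hs v m1,
    ← lintegral_finsetSum _ fun v _ => hs v m2]
  refine lintegral_congr fun x => ?_
  rw [← Finset.mul_sum, ← Finset.mul_sum]
  congr 1
  have h1 : ∑ v, ENNReal.ofReal (velProb U lref x v) * f (x, oppVel v) =
      ∑ v, ENNReal.ofReal (velProb U lref x (oppVel v)) * f (x, v) := by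
    rw [← sum_oppVel]
    simp
  simp only [jump, flip, h1, Finset.mul_sum, Finset.sum_mul]
  rw [Finset.sum_comm]
  refine Finset.sum_congr rfl fun w _ => Finset.sum_congr rfl fun v _ => ?_
  calc _ = (ENNReal.ofReal (rate U lref x v) * ENNReal.ofReal (velProb U lref x w)) *
        (f (x, v) * φ (x, w)) := by ring
    _ = _ := by rw [rate_mul_velProb U hl]; ring

/-! ### Skew detailed balance for paths with n events -/

lemma measurable_jump_eventTerm {U : Pos d → ℝ} (hU : ContDiff ℝ 1 U) (lref : ℝ)
    {g : State d → ℝ≥0∞} (hg : Measurable g) (n : ℕ) {α : Type*} [MeasurableSpace α] {τ : α → ℝ}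
    (hτ : Measurable τ) :
    Measurable fun p : α × State d => jump U lref (eventTerm U lref g n (τ p.1)) p.2 :=
  (measurable_jump hU lref (measurable_eventTerm hU lref hg n)).comp
    (f := fun p : α × State d => (τ p.1, p.2)) (by fun_prop)

lemma measurable_transport_jump_eventTerm {U : Pos d → ℝ} (hU : ContDiff ℝ 1 U) (lref : ℝ)
    {g : State d → ℝ≥0∞} (hg : Measurable g) (n : ℕ) {α : Type*} [MeasurableSpace α] {r τ : α → ℝ}
    (hr : Measurable r) (hτ : Measurable τ) :
    Measurable fun p : α × State d =>
      transport U lref (r p.1) (jump U lref (eventTerm U lref g n (τ p.1))) p.2 :=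
  measurable_transport hU lref hr (Φ := fun a => jump U lref (eventTerm U lref g n (τ a)))
    (measurable_jump_eventTerm hU lref hg n hτ)

lemma measurable_eventTerm_const {U : Pos d → ℝ} (hU : ContDiff ℝ 1 U) (lref : ℝ)
    {g : State d → ℝ≥0∞} (hg : Measurable g) (n : ℕ) (t : ℝ) :
    Measurable (eventTerm U lref g n t) :=
  (measurable_eventTerm hU lref hg n).comp (f := fun z : State d => (t, z)) (by fun_prop)

/-- Tonelli, then the adjoint of the first flight, which passes to the side of `f`. -/
lemma lintegral_mul_eventTerm_succ {U : Pos d → ℝ} (hU : ContDiff ℝ 1 U) (lref : ℝ)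
    {f g : State d → ℝ≥0∞} (hf : Measurable f) (hg : Measurable g) (n : ℕ) (t : ℝ) :
    ∫⁻ z, f z * eventTerm U lref g (n + 1) t z ∂(refMeasure U) =
      ∫⁻ r, ∫⁻ z, flip (transport U lref r (flip f)) z *
        jump U lref (eventTerm U lref g n (t - r)) z ∂(refMeasure U) := by
  have hm : Measurable fun p : ℝ × State d =>
      transport U lref p.1 (jump U lref (eventTerm U lref g n (t - p.1))) p.2 :=
    measurable_transport_jump_eventTerm hU lref hg n (r := fun r => r) (τ := fun r => t - r)
      (by fun_prop) (by fun_prop)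
  calc ∫⁻ z, f z * eventTerm U lref g (n + 1) t z ∂(refMeasure U)
      = ∫⁻ z, ∫⁻ r, f z * transport U lref r (jump U lref (eventTerm U lref g n (t - r))) z
          ∂volume ∂(refMeasure U) := by
        refine lintegral_congr fun z => ?_
        rw [eventTerm, lintegral_const_mul]
        exact hm.comp (f := fun r : ℝ => (r, z)) (by fun_prop)
    _ = ∫⁻ r, ∫⁻ z, f z * transport U lref r (jump U lref (eventTerm U lref g n (t - r))) z
          ∂(refMeasure U) := by
        rw [lintegral_lintegral_swap]
        exact ((hf.comp measurable_fst).mul (hm.comp measurable_swap)).aemeasurable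
    _ = _ := lintegral_congr fun r => lintegral_mul_transport hU lref r hf
        (measurable_jump_const hU lref (measurable_eventTerm_const hU lref hg n _))

lemma lintegral_flip_eventTerm_succ_mul {U : Pos d → ℝ} (hU : ContDiff ℝ 1 U) (lref : ℝ)
    {f φ : State d → ℝ≥0∞} (hf : Measurable f) (hφ : Measurable φ) (n : ℕ) (t : ℝ) :
    ∫⁻ z, flip (eventTerm U lref f (n + 1) t) z * φ z ∂(refMeasure U) =
      ∫⁻ r, ∫⁻ z, flip (transport U lref r (jump U lref (eventTerm U lref f n (t - r)))) z * φ z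
        ∂(refMeasure U) := by
  have hm : Measurable fun p : ℝ × State d =>
      flip (transport U lref p.1 (jump U lref (eventTerm U lref f n (t - p.1)))) p.2 :=
    measurable_flip
      (Φ := fun r => transport U lref r (jump U lref (eventTerm U lref f n (t - r))))
      (measurable_transport_jump_eventTerm hU lref hf n (r := fun r => r) (τ := fun r => t - r)
        (by fun_prop) (by fun_prop))
  rw [lintegral_lintegral_swap
    ((hm.mul (hφ.comp measurable_snd)).aemeasurable)]
  refine lintegral_congr fun z => ?_
  rw [lintegral_mul_const]
  · rfl
  · exact hm.comp (f := fun r : ℝ => (r, z)) (by fun_prop)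

/-- An event may be moved from the forward to the backward part of the path. -/
lemma lintegral_flip_eventTerm_mul_jump_succ {U : Pos d → ℝ} (hU : ContDiff ℝ 1 U) {lref : ℝ}
    (hl : 0 < lref) {f g : State d → ℝ≥0∞} (hf : Measurable f) (hg : Measurable g) (k l : ℕ)
    (t : ℝ) :
    ∫⁻ s, ∫⁻ z, flip (eventTerm U lref f k s) z *
        jump U lref (eventTerm U lref g (l + 1) (t - s)) z ∂(refMeasure U) =
      ∫⁻ s, ∫⁻ z, flip (eventTerm U lref f (k + 1) s) z *
        jump U lref (eventTerm U lref g l (t - s)) z ∂(refMeasure U) := by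
  -- Here s is the duration of the backward part, r that of the flight being moved, and t - (s + r)
  -- what remains for the forward part.
  set G : ℝ → ℝ → ℝ≥0∞ := fun s r =>
    ∫⁻ z, flip (transport U lref r (jump U lref (eventTerm U lref f k s))) z *
      jump U lref (eventTerm U lref g l (t - (s + r))) z ∂(refMeasure U) with hGdef
  have hG : Measurable fun p : ℝ × ℝ => G p.1 p.2 := by
    refine Measurable.lintegral_prod_right' (f := fun p : (ℝ × ℝ) × State d =>
      flip (transport U lref p.1.2 (jump U lref (eventTerm U lref f k p.1.1))) p.2 *
        jump U lref (eventTerm U lref g l (t - (p.1.1 + p.1.2))) p.2) (Measurable.mul ?_ ?_)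
    · exact measurable_flip (α := ℝ × ℝ)
        (Φ := fun q => transport U lref q.2 (jump U lref (eventTerm U lref f k q.1)))
        (measurable_transport_jump_eventTerm hU lref hf k (r := fun q : ℝ × ℝ => q.2)
          (τ := fun q => q.1) measurable_snd measurable_fst)
    · exact measurable_jump_eventTerm hU lref hg l (α := ℝ × ℝ) (τ := fun q => t - (q.1 + q.2))
        (by fun_prop)
  calc _ = ∫⁻ s, ∫⁻ r, G s r := by
        refine lintegral_congr fun s => ?_
        have hu := measurable_eventTerm_const hU lref hf k s
        rw [lintegral_mul_jump hU hl (measurable_flip_const hu)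
          (measurable_eventTerm_const hU lref hg _ _), flip_flip,
          lintegral_mul_eventTerm_succ hU lref
            (measurable_flip_const (measurable_jump_const hU lref hu)) hg]
        simp only [flip_flip, hGdef, sub_sub]
    _ = ∫⁻ r, ∫⁻ s, G s r := lintegral_lintegral_swap hG.aemeasurable
    -- After this shift s is the duration of the backward part with the moved flight included.
    _ = ∫⁻ r, ∫⁻ s, G (s - r) r :=
        lintegral_congr fun r => (lintegral_sub_right_eq_self (fun s => G s r) r).symm
    _ = ∫⁻ s, ∫⁻ r, G (s - r) r := by
        refine lintegral_lintegral_swap (Measurable.aemeasurable ?_)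
        exact hG.comp (f := fun p : ℝ × ℝ => (p.2 - p.1, p.1)) (by fun_prop)
    _ = _ := by
        refine lintegral_congr fun s => ?_
        rw [lintegral_flip_eventTerm_succ_mul hU lref hf
          (measurable_jump_const hU lref (measurable_eventTerm_const hU lref hg _ _))]
        simp only [hGdef, sub_add_cancel]

/-- Iterates the exchange until the forward part is a single flight without events. -/
lemma lintegral_flip_eventTerm_mul_jump_comm {U : Pos d → ℝ} (hU : ContDiff ℝ 1 U) {lref : ℝ}
    (hl : 0 < lref) {f g : State d → ℝ≥0∞} (hf : Measurable f) (hg : Measurable g) (k l : ℕ)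
    (t : ℝ) :
    ∫⁻ s, ∫⁻ z, flip (eventTerm U lref f k s) z *
        jump U lref (eventTerm U lref g l (t - s)) z ∂(refMeasure U) =
      ∫⁻ s, ∫⁻ z, flip (eventTerm U lref f (k + l) s) z *
        jump U lref (eventTerm U lref g 0 (t - s)) z ∂(refMeasure U) := by
  induction l generalizing k with
  | zero => rfl
  | succ l ih =>
    rw [lintegral_flip_eventTerm_mul_jump_succ hU hl hf hg, ih (k + 1), Nat.add_right_comm,
      Nat.add_assoc]

/-- Skew detailed balance for the paths with exactly `n` events. -/
lemma lintegral_mul_eventTerm {U : Pos d → ℝ} (hU : ContDiff ℝ 1 U) {lref : ℝ} (hl : 0 < lref)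
    {f g : State d → ℝ≥0∞} (hf : Measurable f) (hg : Measurable g) (n : ℕ) (t : ℝ) :
    ∫⁻ z, f z * eventTerm U lref g n t z ∂(refMeasure U) =
      ∫⁻ z, flip (eventTerm U lref (flip f) n t) z * g z ∂(refMeasure U) := by
  have hff := measurable_flip_const hf
  cases n with
  | zero => exact lintegral_mul_transport hU lref t hf hg
  | succ n =>
    -- With k = 0 and `flip f`, the backward part is exactly the adjoint of the first flight, so the
    -- left side of `h` is the expansion of the goal at its first event.
    have h := lintegral_flip_eventTerm_mul_jump_comm hU hl hff hg 0 n t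
    rw [lintegral_mul_eventTerm_succ hU lref hf hg]
    refine h.trans ?_
    -- The reflection r = t - s matches the two parametrisations; one jump and one flight are then
    -- left to move across.
    rw [Nat.zero_add, lintegral_flip_eventTerm_succ_mul hU lref hff hg,
      ← lintegral_sub_left_eq_self (fun r => ∫⁻ z, flip (transport U lref r (jump U lref
        (eventTerm U lref (flip f) n (t - r)))) z * g z ∂(refMeasure U)) t]
    refine lintegral_congr fun s => ?_
    have hu := measurable_eventTerm_const hU lref hff n s
    rw [lintegral_mul_jump hU hl (measurable_flip_const hu)
      (measurable_eventTerm_const hU lref hg _ _), flip_flip, sub_sub_cancel]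
    rw [eventTerm, lintegral_mul_transport hU lref _
      (measurable_flip_const (measurable_jump_const hU lref hu)) hg, flip_flip]

/-! ### The transition kernel as a sum over the number of events -/

lemma measurable_eventCount (t : ℝ) : Measurable fun ω : ℕ → Mark d => eventCount ω t := by
  classical
  -- The second alternative makes the predicate always satisfiable, so that `Nat.find` returns 0
  -- when no event occurs after t, in agreement with `sInf ∅ = 0`.
  have hex : ∀ ω : ℕ → Mark d, ∃ n, t < (ω (n + 1)).1 ∨ ∀ j, ¬ t < (ω (j + 1)).1 := fun ω => by
    by_cases h : ∃ n, t < (ω (n + 1)).1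
    · exact h.imp fun n hn => Or.inl hn
    · exact ⟨0, Or.inr (not_exists.1 h)⟩
  have hms : ∀ k, MeasurableSet {ω : ℕ → Mark d | t < (ω (k + 1)).1} := fun k =>
    measurableSet_lt measurable_const (by fun_prop)
  have heq : (fun ω : ℕ → Mark d => eventCount ω t) = fun ω => Nat.find (hex ω) := by
    ext ω
    symm
    rw [Nat.find_eq_iff]
    rcases Set.eq_empty_or_nonempty {n | t < (ω (n + 1)).1} with h | h
    · have h0 : eventCount ω t = 0 := by rw [eventCount, h, Nat.sInf_empty]
      have hn : ∀ j, ¬ t < (ω (j + 1)).1 := fun j hj => by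
        have : j ∈ {n | t < (ω (n + 1)).1} := hj
        simp [h] at this
      exact ⟨Or.inr hn, by simp [h0]⟩
    · refine ⟨Or.inl (Nat.sInf_mem h), fun n hn hc => ?_⟩
      rcases hc with hc | hc
      · exact Nat.notMem_of_lt_sInf hn hc
      · obtain ⟨k, hk⟩ := h
        exact hc k hk
  rw [heq]
  have hA : MeasurableSet {ω : ℕ → Mark d | ∀ j, ¬ t < (ω (j + 1)).1} := by
    rw [Set.ofPred_forall]
    exact MeasurableSet.iInter fun j => (hms j).compl
  exact measurable_find hex fun k => (hms k).union hA

lemma measurable_stateAt (t : ℝ) : Measurable (stateAt (d := d) t) := by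
  have h : Measurable fun p : ℕ × (ℕ → Mark d) =>
      ((flowPos (p.2 p.1).2 (t - (p.2 p.1).1), (p.2 p.1).2.2) : State d) := by
    refine measurable_from_prod_countable_right fun n => ?_
    have h1 := measurable_flowPos.comp
      (f := fun ω : ℕ → Mark d => ((ω n).2, t - (ω n).1)) (by fun_prop)
    exact h1.prodMk (by fun_prop)
  exact h.comp (f := fun ω : ℕ → Mark d => (eventCount ω t, ω))
    ((measurable_eventCount t).prodMk measurable_id)

lemma isMarkovKernel_transition {U : Pos d → ℝ} (hU : ContDiff ℝ 1 U) {lref : ℝ} (hl : 0 < lref)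
    (t : ℝ) : IsMarkovKernel (transition hU hl t) :=
  haveI := isMarkovKernel_skeletonLaw hU hl
  Kernel.IsMarkovKernel.map _ (measurable_stateAt t)

lemma ofReal_holdDensity {U : Pos d → ℝ} {lref : ℝ} (hl : 0 < lref) (z : State d) {r : ℝ}
    (hr : 0 ≤ r) : ENNReal.ofReal (holdDensity U lref z r) =
      survival U lref z r * ENNReal.ofReal (rate U lref (flowPos z r) z.2) := by
  rw [survival, if_pos hr, holdDensity, ENNReal.ofReal_mul (hl.le.trans (rate_ge _ _ _ _)),
    mul_comm]
  rfl

/-- Memorylessness: after time a, the holding density is the survival factor times the holding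
density from the state reached at a, and the latter has mass one. -/
lemma lintegral_holdDensity_Ioi {U : Pos d → ℝ} (hU : ContDiff ℝ 1 U) {lref : ℝ} (hl : 0 < lref)
    (z : State d) {a : ℝ} (ha : 0 ≤ a) :
    ∫⁻ r in Set.Ioi a, ENNReal.ofReal (holdDensity U lref z r) = survival U lref z a := by
  have hc := continuous_rate_line hU lref z.1 z.2 z.2
  have h1 : ∀ r, holdDensity U lref z (r + a) =
      Real.exp (-∫ s in (0 : ℝ)..a, rate U lref (z.1 + s • (z.2 : Pos d)) z.2) *
        holdDensity U lref (flowPos z a, z.2) r := by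
    intro r
    have h2 : ∫ s in (0 : ℝ)..r, rate U lref (flowPos z a + s • (z.2 : Pos d)) z.2 =
        ∫ s in a..(r + a), rate U lref (z.1 + s • (z.2 : Pos d)) z.2 := by
      have := intervalIntegral.integral_comp_add_right (a := 0) (b := r)
        (fun s => rate U lref (z.1 + s • (z.2 : Pos d)) z.2) a
      rw [zero_add] at this
      rw [← this]
      refine intervalIntegral.integral_congr fun s _ => ?_
      simp only [flowPos, add_smul]
      congr 1
      abel
    have h3 : flowPos z a + r • (z.2 : Pos d) = z.1 + (r + a) • (z.2 : Pos d) := by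
      simp only [flowPos, add_smul]
      abel
    simp only [holdDensity]
    rw [h2, h3, ← intervalIntegral.integral_add_adjacent_intervals (b := a)
      (hc.intervalIntegrable _ _) (hc.intervalIntegrable _ _), neg_add, Real.exp_add]
    ring
  have hm : Measurable fun r => ENNReal.ofReal (holdDensity U lref (flowPos z a, z.2) r) :=
    ENNReal.measurable_ofReal.comp ((continuous_holdDensity hU lref).comp
      (f := fun r : ℝ => ((flowPos z a, z.2), r)) (by fun_prop)).measurable
  calc ∫⁻ r in Set.Ioi a, ENNReal.ofReal (holdDensity U lref z r)
      = ∫⁻ r in Set.Ioi (0 : ℝ), ENNReal.ofReal (holdDensity U lref z (r + a)) := by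
        rw [← lintegral_indicator measurableSet_Ioi, ← lintegral_indicator measurableSet_Ioi,
          ← lintegral_add_right_eq_self _ a]
        refine lintegral_congr fun r => ?_
        simp only [Set.indicator, Set.mem_Ioi, lt_add_iff_pos_left]
    _ = _ := by
        simp only [h1, ENNReal.ofReal_mul (Real.exp_pos _).le]
        rw [lintegral_const_mul _ hm, lintegral_holdDensity hU hl, mul_one, survival, if_pos ha]

lemma stepKernel_lt {U : Pos d → ℝ} (hU : ContDiff ℝ 1 U) {lref : ℝ} (hl : 0 < lref)
    (m : Mark d) {t : ℝ} (hm : m.1 ≤ t) :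
    stepKernel U lref m {y | t < y.1} = survival U lref m.2 (t - m.1) := by
  have hs : MeasurableSet {y : Mark d | t < y.1} :=
    measurableSet_lt measurable_const measurable_fst
  rw [← lintegral_indicator_one hs, lintegral_stepKernel hU hl m (measurable_one.indicator hs),
    ← lintegral_holdDensity_Ioi hU hl m.2 (sub_nonneg.2 hm),
    ← lintegral_indicator measurableSet_Ioi, ← lintegral_indicator measurableSet_Ioi]
  have h1 : ∀ (r : ℝ) (w : Vel d),
      ({y : Mark d | t < y.1}.indicator 1 (m.1 + r, (flowPos m.2 r, w)) : ℝ≥0∞) =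
        (Set.Ioi (t - m.1)).indicator 1 r := fun r w => by
    simp only [Set.indicator, Set.mem_ofPred_eq, Set.mem_Ioi, sub_lt_iff_lt_add']
    rfl
  simp only [h1, ← Finset.sum_mul, sum_ofReal_velProb hU hl, one_mul]
  refine lintegral_congr fun r => ?_
  by_cases hr : t - m.1 < r
  · have h0 : 0 < r := (sub_nonneg.2 hm).trans_lt hr
    simp [hr, h0]
  · simp [hr]

/-- Decomposition at the first event: the holding density is survival times rate, and these factors
together with the choice of velocity are `transport` applied to `jump`. -/
lemma lintegral_eventTerm_stepKernel {U : Pos d → ℝ} (hU : ContDiff ℝ 1 U) {lref : ℝ}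
    (hl : 0 < lref) {g : State d → ℝ≥0∞} (hg : Measurable g) (n : ℕ) (t : ℝ) (m : Mark d) :
    ∫⁻ y, eventTerm U lref g n (t - y.1) y.2 ∂(stepKernel U lref m) =
      eventTerm U lref g (n + 1) (t - m.1) m.2 := by
  have hF : Measurable fun y : Mark d => eventTerm U lref g n (t - y.1) y.2 :=
    (measurable_eventTerm hU lref hg n).comp (f := fun y : Mark d => (t - y.1, y.2))
      (by fun_prop)
  rw [lintegral_stepKernel hU hl m hF, ← lintegral_indicator measurableSet_Ioi, eventTerm]
  refine lintegral_congr_ae ?_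
  -- At r = 0 the indicator of `Ioi 0` vanishes but `survival` equals one, so this null set is
  -- discarded.
  filter_upwards [Measure.ae_ne volume (0 : ℝ)] with r hr
  rcases lt_or_gt_of_ne hr with h | h
  · rw [Set.indicator_of_notMem (by simpa using h.le), transport, survival, if_neg (not_le.2 h),
      zero_mul]
  · rw [Set.indicator_of_mem (Set.mem_Ioi.2 h), ofReal_holdDensity hl _ h.le, mul_assoc,
      transport, jump]
    simp only [sub_sub]

/-- Each step of the skeleton is traded for one more event, so k stays free in the induction on n.
-/
lemma lintegral_eventTerm_skeletonLaw {U : Pos d → ℝ} (hU : ContDiff ℝ 1 U) {lref : ℝ}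
    (hl : 0 < lref) {g : State d → ℝ≥0∞} (hg : Measurable g) (z : State d) (t : ℝ) (n k : ℕ) :
    ∫⁻ ω, eventTerm U lref g k (t - (ω n).1) (ω n).2 ∂(skeletonLaw hU hl z) =
      eventTerm U lref g (k + n) t z := by
  have := isMarkovKernel_skeletonLaw hU hl
  induction n generalizing k with
  | zero =>
    have : (fun ω : ℕ → Mark d => eventTerm U lref g k (t - (ω 0).1) (ω 0).2)
        =ᵐ[skeletonLaw hU hl z] fun _ => eventTerm U lref g k t z := by
      filter_upwards [ae_skeletonLaw_zero hU hl z] with ω h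
      simp [h]
    rw [lintegral_congr_ae this]
    simp
  | succ n ih =>
    have hF : Measurable fun q : Mark d × Mark d => eventTerm U lref g k (t - q.2.1) q.2.2 :=
      (measurable_eventTerm hU lref hg k).comp
        (f := fun q : Mark d × Mark d => (t - q.2.1, q.2.2)) (by fun_prop)
    rw [lintegral_skeletonLaw_succ hU hl z n hF]
    simp only [lintegral_eventTerm_stepKernel hU hl hg]
    rw [ih (k + 1), Nat.add_right_comm, Nat.add_assoc]

/-- The contribution to `g(Z_t)` of the event that `t` lies between two successive event times. -/
noncomputable def betweenEvents (g : State d → ℝ≥0∞) (t : ℝ) (q : Mark d × Mark d) : ℝ≥0∞ :=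
  if q.1.1 ≤ t ∧ t < q.2.1 then g (flowPos q.1.2 (t - q.1.1), q.1.2.2) else 0

lemma measurable_betweenEvents {g : State d → ℝ≥0∞} (hg : Measurable g) (t : ℝ) :
    Measurable (betweenEvents g t) := by
  refine Measurable.ite (MeasurableSet.inter
    (measurableSet_le (f := fun q : Mark d × Mark d => q.1.1) (by fun_prop) measurable_const)
    (measurableSet_lt (g := fun q : Mark d × Mark d => q.2.1) measurable_const (by fun_prop)))
    ?_ measurable_const
  have h1 := measurable_flowPos.comp
    (f := fun q : Mark d × Mark d => (q.1.2, t - q.1.1)) (by fun_prop)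
  exact hg.comp (h1.prodMk (by fun_prop))

lemma apply_stateAt_eq_tsum {g : State d → ℝ≥0∞} {t : ℝ} {ω : ℕ → Mark d}
    (h0 : (ω 0).1 ≤ t) (hmono : StrictMono fun n => (ω n).1)
    (htop : Tendsto (fun n => (ω n).1) atTop atTop) :
    g (stateAt t ω) = ∑' n, betweenEvents g t (ω n, ω (n + 1)) := by
  -- Divergence of the event times rules out the default value of `sInf`; exactly the term at
  -- `eventCount ω t` then survives.
  have hne : {n | t < (ω (n + 1)).1}.Nonempty :=
    (((tendsto_add_atTop_iff_nat 1).2 htop).eventually_gt_atTop t).exists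
  have hlt : t < (ω (eventCount ω t + 1)).1 := Nat.sInf_mem hne
  have hle : (ω (eventCount ω t)).1 ≤ t := by
    rcases Nat.eq_zero_or_pos (eventCount ω t) with h | h
    · rwa [h]
    · obtain ⟨k, hk⟩ := Nat.exists_eq_succ_of_ne_zero h.ne'
      rw [hk]
      exact not_lt.1 (Nat.notMem_of_lt_sInf (s := {n | t < (ω (n + 1)).1})
        (show k < eventCount ω t by omega))
  rw [tsum_eq_single (eventCount ω t)]
  · rw [betweenEvents, if_pos ⟨hle, hlt⟩]
    rfl
  · intro n hn
    refine if_neg fun h => ?_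
    rcases lt_or_gt_of_ne hn with h' | h'
    · have : (ω (n + 1)).1 ≤ (ω (eventCount ω t)).1 := hmono.monotone (by omega)
      exact absurd h.2 (not_lt.2 (this.trans hle))
    · have : (ω (eventCount ω t + 1)).1 ≤ (ω n).1 := hmono.monotone (by omega)
      exact absurd h.1 (not_le.2 (hlt.trans_le this))

lemma lintegral_betweenEvents_stepKernel {U : Pos d → ℝ} (hU : ContDiff ℝ 1 U) {lref : ℝ}
    (hl : 0 < lref) (g : State d → ℝ≥0∞) (t : ℝ) (m : Mark d) :
    ∫⁻ y, betweenEvents g t (m, y) ∂(stepKernel U lref m) =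
      eventTerm U lref g 0 (t - m.1) m.2 := by
  have hs : MeasurableSet {y : Mark d | t < y.1} :=
    measurableSet_lt measurable_const measurable_fst
  rw [eventTerm, transport]
  by_cases hm : m.1 ≤ t
  · rw [← stepKernel_lt hU hl m hm, mul_comm, ← lintegral_indicator_const hs]
    refine lintegral_congr fun y => ?_
    simp [betweenEvents, Set.indicator, hm]
  · rw [survival, if_neg (by simpa using hm), zero_mul, ← lintegral_zero]
    refine lintegral_congr fun y => ?_
    simp [betweenEvents, hm]

/-- The transition kernel is the sum over the number of events. -/
lemma lintegral_transition {U : Pos d → ℝ} (hU : ContDiff ℝ 1 U) {lref : ℝ} (hl : 0 < lref)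
    {t : ℝ} (ht : 0 ≤ t) {g : State d → ℝ≥0∞} (hg : Measurable g) (z : State d) :
    ∫⁻ y, g y ∂(transition hU hl t z) = ∑' n, eventTerm U lref g n t z := by
  have hb := measurable_betweenEvents hg t
  rw [transition, Kernel.map_apply _ (measurable_stateAt t),
    lintegral_map hg (measurable_stateAt t)]
  have hae : (fun ω => g (stateAt t ω)) =ᵐ[skeletonLaw hU hl z]
      fun ω => ∑' n, betweenEvents g t (ω n, ω (n + 1)) := by
    filter_upwards [ae_skeletonLaw_zero hU hl z, ae_skeletonLaw_nonexplosive hU hl z] with ω h0 h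
    exact apply_stateAt_eq_tsum (by simpa [h0] using ht) h.1 h.2
  have hbn : ∀ n, AEMeasurable (fun ω : ℕ → Mark d => betweenEvents g t (ω n, ω (n + 1)))
      (skeletonLaw hU hl z) := fun n => (hb.comp (by fun_prop)).aemeasurable
  rw [lintegral_congr_ae hae, lintegral_tsum hbn]
  refine tsum_congr fun n => ?_
  rw [lintegral_skeletonLaw_succ hU hl z n hb]
  simp only [lintegral_betweenEvents_stepKernel hU hl]
  rw [lintegral_eventTerm_skeletonLaw hU hl hg, Nat.zero_add]

lemma lintegral_transition_refMeasure {U : Pos d → ℝ} (hU : ContDiff ℝ 1 U) {lref : ℝ}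
    (hl : 0 < lref) {t : ℝ} (ht : 0 ≤ t) {g : State d → ℝ≥0∞} (hg : Measurable g) :
    ∫⁻ z, ∫⁻ y, g y ∂(transition hU hl t z) ∂(refMeasure U) = ∫⁻ z, g z ∂(refMeasure U) := by
  have := isMarkovKernel_transition hU hl t
  -- Conservation of mass P_t 1 = 1, expanded in the number of events; this is where non-explosion
  -- enters invariance.
  have hone : ∀ z, ∑' n, eventTerm U lref (fun _ => 1) n t z = 1 := fun z => by
    rw [← lintegral_transition hU hl ht measurable_const z]
    simp
  have hmt : ∀ {f : State d → ℝ≥0∞}, Measurable f → ∀ n, Measurable (eventTerm U lref f n t) :=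
    fun hf n => measurable_eventTerm_const hU lref hf n t
  calc ∫⁻ z, ∫⁻ y, g y ∂(transition hU hl t z) ∂(refMeasure U)
      -- The factor 1 is the test function onto which all flights and jumps are moved.
      = ∑' n, ∫⁻ z, 1 * eventTerm U lref g n t z ∂(refMeasure U) := by
        simp only [lintegral_transition hU hl ht hg, one_mul]
        exact lintegral_tsum fun n => (hmt hg n).aemeasurable
    _ = ∑' n, ∫⁻ z, flip (eventTerm U lref (fun _ => 1) n t) z * g z ∂(refMeasure U) :=
        tsum_congr fun n =>
          lintegral_mul_eventTerm hU hl (f := fun _ => 1) measurable_const hg n t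
    _ = ∫⁻ z, (∑' n, flip (eventTerm U lref (fun _ => 1) n t) z) * g z ∂(refMeasure U) := by
        have hm : ∀ n, AEMeasurable
            (fun z => flip (eventTerm U lref (fun _ => 1) n t) z * g z) (refMeasure U) := fun n =>
          ((measurable_flip_const (hmt measurable_const n)).mul hg).aemeasurable
        rw [← lintegral_tsum hm]
        simp only [ENNReal.tsum_mul_right]
    _ = ∫⁻ z, g z ∂(refMeasure U) := by
        simp only [flip, hone, one_mul]

/-! ### Passage to the normalised target -/

/-- The normalising constant of the target. -/
noncomputable def targetConst (U : Pos d → ℝ) : ℝ≥0∞ :=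
  ENNReal.ofReal (∫ x, Real.exp (-U x))⁻¹ * (Fintype.card (Vel d) : ℝ≥0∞)⁻¹

lemma target_eq_smul {U : Pos d → ℝ} (hU : ContDiff ℝ 1 U) :
    target U = targetConst U • refMeasure U := by
  have hc := hU.continuous
  have h1 : (volume : Measure (Pos d)).tilted (fun x => -U x) =
      ENNReal.ofReal (∫ x, Real.exp (-U x))⁻¹ •
        (volume : Measure (Pos d)).withDensity fun x => ENNReal.ofReal (Real.exp (-U x)) := by
    rw [← withDensity_smul _ (by fun_prop), Measure.tilted]
    congr 1
    ext x
    simp only [Pi.smul_apply, smul_eq_mul]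
    rw [← ENNReal.ofReal_mul (by positivity), div_eq_inv_mul]
  have h2 : uniformOn (Set.univ : Set (Vel d)) =
      (Fintype.card (Vel d) : ℝ≥0∞)⁻¹ • Measure.count := by
    ext s _
    rw [uniformOn_univ, Measure.smul_apply, smul_eq_mul, ENNReal.div_eq_inv_mul]
  rw [target, h1, h2, Measure.prod_smul_left, Measure.prod_smul_right, smul_smul, targetConst,
    refMeasure]

lemma isProbabilityMeasure_target {U : Pos d → ℝ}
    (hint : Integrable (fun x => Real.exp (-U x)) volume) : IsProbabilityMeasure (target U) := by
  have := isProbabilityMeasure_tilted hint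
  unfold target
  infer_instance

lemma invariant_transition {U : Pos d → ℝ} (hU : ContDiff ℝ 1 U) {lref : ℝ} (hl : 0 < lref)
    {t : ℝ} (ht : 0 ≤ t) : Kernel.Invariant (transition hU hl t) (target U) := by
  unfold Kernel.Invariant
  ext s hs
  rw [Measure.bind_apply hs (Kernel.aemeasurable _), target_eq_smul hU, lintegral_smul_measure,
    Measure.smul_apply]
  congr 1
  have := lintegral_transition_refMeasure hU hl ht (measurable_one.indicator hs)
  simpa only [lintegral_indicator_one hs] using this

/-! ### Infinitesimal invariance -/

lemma targetConst_ne_top (U : Pos d → ℝ) : targetConst U ≠ ∞ :=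
  ENNReal.mul_ne_top ENNReal.ofReal_ne_top (ENNReal.inv_ne_top.2 (Nat.cast_ne_zero.2 Fintype.card_ne_zero))

lemma targetConst_ne_zero {U : Pos d → ℝ} (hint : Integrable (fun x => Real.exp (-U x)) volume) :
    targetConst U ≠ 0 := by
  have hpos : 0 < ∫ x, Real.exp (-U x) := integral_exp_pos hint
  exact mul_ne_zero (ENNReal.ofReal_pos.2 (inv_pos.2 hpos)).ne'
    (ENNReal.inv_ne_zero.2 (ENNReal.natCast_ne_top _))

lemma integrable_target_iff {U : Pos d → ℝ} (hU : ContDiff ℝ 1 U)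
    (hint : Integrable (fun x => Real.exp (-U x)) volume) {F : State d → ℝ} :
    Integrable F (target U) ↔ Integrable F (refMeasure U) := by
  rw [target_eq_smul hU, integrable_smul_measure (targetConst_ne_zero hint) (targetConst_ne_top U)]

lemma integrable_withDensity_exp_iff {U : Pos d → ℝ} (hU : ContDiff ℝ 1 U) {F : Pos d → ℝ} :
    Integrable F ((volume : Measure (Pos d)).withDensity
      fun x => ENNReal.ofReal (Real.exp (-U x))) ↔
      Integrable (fun x => Real.exp (-U x) * F x) volume := by
  have hc := hU.continuous
  rw [integrable_withDensity_iff_integrable_smul' (by fun_prop) (by simp)]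
  simp only [ENNReal.toReal_ofReal (Real.exp_pos _).le, smul_eq_mul]

/-- Almost everywhere for counting measure means everywhere, so integrability on the product holds
on the slice of every velocity. -/
lemma integrable_slice {U : Pos d → ℝ} (hU : ContDiff ℝ 1 U) {F : State d → ℝ}
    (hF : Integrable F (refMeasure U)) (v : Vel d) :
    Integrable (fun x => Real.exp (-U x) * F (x, v)) volume := by
  rw [← integrable_withDensity_exp_iff hU (F := fun x => F (x, v))]
  have := hF.prod_left_ae
  rw [Measure.ae_count_iff] at this
  exact this v

lemma integrable_refMeasure {U : Pos d → ℝ} (hU : ContDiff ℝ 1 U) {F : State d → ℝ}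
    (hm : Measurable F) (hF : ∀ v, Integrable (fun x => Real.exp (-U x) * F (x, v)) volume) :
    Integrable F (refMeasure U) := by
  rw [refMeasure, integrable_prod_iff' hm.aestronglyMeasurable]
  exact ⟨Eventually.of_forall fun v => (integrable_withDensity_exp_iff hU).2 (hF v),
    Integrable.of_finite⟩

lemma integral_refMeasure {U : Pos d → ℝ} (hU : ContDiff ℝ 1 U) {F : State d → ℝ}
    (hF : Integrable F (refMeasure U)) :
    ∫ z, F z ∂(refMeasure U) = ∑ v, ∫ x, Real.exp (-U x) * F (x, v) := by
  have hc := hU.continuous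
  rw [refMeasure, integral_prod_symm _ hF, integral_count]
  refine Finset.sum_congr rfl fun v _ => ?_
  rw [integral_withDensity_eq_integral_toReal_smul (by fun_prop) (by simp)]
  simp only [ENNReal.toReal_ofReal (Real.exp_pos _).le, smul_eq_mul]

lemma drift_eq_fderiv {f : State d → ℝ} {v : Vel d}
    (hf : Differentiable ℝ fun x => f (x, v)) (x : Pos d) :
    drift f (x, v) = fderiv ℝ (fun y => f (y, v)) x v := by
  rw [(hf x).hasGradientAt.hasFDerivAt.fderiv, InnerProductSpace.toDual_apply_apply]
  rfl

/-- Expressing the derivative of the weight through the rates makes integration by parts produce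
only terms that `Admissible` controls. -/
lemma fderiv_exp_neg_apply {U : Pos d → ℝ} (hU : ContDiff ℝ 1 U) (lref : ℝ) (x v : Pos d) :
    fderiv ℝ (fun x => Real.exp (-U x)) x v =
      Real.exp (-U x) * (rate U lref x (-v) - rate U lref x v) := by
  have hd := hU.differentiable (by norm_num) x
  have h := hd.hasGradientAt.hasFDerivAt.neg.exp
  have h' : fderiv ℝ (fun x => Real.exp (-U x)) x =
      Real.exp (-U x) • -(InnerProductSpace.toDual ℝ (Pos d)) (gradient U x) := h.fderiv
  rw [h', ← neg_sub, rate_sub_rate_neg, real_inner_comm]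
  simp

/-- Integration by parts in the direction of a velocity. -/
lemma integral_exp_mul_drift {U : Pos d → ℝ} (hU : ContDiff ℝ 1 U) {lref : ℝ} (hl : 0 < lref)
    {f : State d → ℝ} {v : Vel d} (hf : Differentiable ℝ fun x => f (x, v))
    (h1 : Integrable (fun x => Real.exp (-U x) * drift f (x, v)) volume)
    (h2 : Integrable (fun x => Real.exp (-U x) * (rate U lref x v * f (x, v))) volume)
    (h3 : Integrable (fun x => Real.exp (-U x) * (rate U lref x (-(v : Pos d)) * f (x, v)))
      volume) :
    ∫ x, Real.exp (-U x) * drift f (x, v) =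
      (∫ x, Real.exp (-U x) * (rate U lref x v * f (x, v))) -
        ∫ x, Real.exp (-U x) * (rate U lref x (-(v : Pos d)) * f (x, v)) := by
  have hfc : Continuous fun x => f (x, v) := hf.continuous
  have hd : Differentiable ℝ fun x => Real.exp (-U x) :=
    ((hU.differentiable (by norm_num)).neg).exp
  have e1 : ∀ x, fderiv ℝ (fun y => f (y, v)) x v * Real.exp (-U x) =
      Real.exp (-U x) * drift f (x, v) := fun x => by rw [drift_eq_fderiv hf, mul_comm]
  have e2 : ∀ x, f (x, v) * fderiv ℝ (fun x => Real.exp (-U x)) x v =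
      Real.exp (-U x) * (rate U lref x (-(v : Pos d)) * f (x, v)) -
        Real.exp (-U x) * (rate U lref x v * f (x, v)) := fun x => by
    rw [fderiv_exp_neg_apply hU lref]; ring
  -- Integration by parts without boundary terms needs the product itself to be integrable; this
  -- follows from the bound on λf because λ ≥ `lref` > 0.
  have h0 : Integrable (fun x => f (x, v) * Real.exp (-U x)) volume := by
    refine (h2.norm.const_mul lref⁻¹).mono' (hfc.mul hd.continuous).aestronglyMeasurable
      (Eventually.of_forall fun x => ?_)
    have hr := rate_ge U lref x v
    rw [norm_mul, norm_mul, norm_mul, Real.norm_of_nonneg (hl.le.trans hr),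
      Real.norm_of_nonneg (Real.exp_pos _).le, inv_mul_eq_div, le_div_iff₀ hl]
    calc ‖f (x, v)‖ * Real.exp (-U x) * lref
        = Real.exp (-U x) * (lref * ‖f (x, v)‖) := by ring
      _ ≤ _ := by gcongr
  have key := integral_mul_fderiv_eq_neg_fderiv_mul_of_integrable (μ := (volume : Measure (Pos d)))
    (f := fun x => f (x, v)) (g := fun x => Real.exp (-U x)) (v := (v : Pos d))
    (by simpa only [e1] using h1) (by simp only [e2]; exact h3.sub h2) h0
    (fun x _ => hf x) (fun x _ => hd x)
  simp only [e1, e2] at key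
  rw [integral_sub h3 h2] at key
  linarith

lemma totalRate_pos (U : Pos d → ℝ) {lref : ℝ} (hl : 0 < lref) (x : Pos d) :
    0 < totalRate U lref x :=
  Finset.sum_pos (fun _ _ => hl.trans_le (rate_ge _ _ _ _)) Finset.univ_nonempty

lemma continuous_rate_left {U : Pos d → ℝ} (hU : ContDiff ℝ 1 U) (lref : ℝ) (v : Pos d) :
    Continuous fun x => rate U lref x v :=
  (continuous_rate hU lref).comp (f := fun x => (x, v)) (by fun_prop)

lemma continuous_totalRate {U : Pos d → ℝ} (hU : ContDiff ℝ 1 U) (lref : ℝ) :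
    Continuous (totalRate U lref) :=
  continuous_finsetSum _ fun v _ => continuous_rate_left hU lref v

/-- The term `λ(x, v) ∑_w λ(x, -w) / λ(x) f(x, w)` of the generator. -/
noncomputable def gain (U : Pos d → ℝ) (lref : ℝ) (f : State d → ℝ) (z : State d) : ℝ :=
  rate U lref z.1 z.2 *
    ∑ w : Vel d, rate U lref z.1 (-(w : Pos d)) / totalRate U lref z.1 * f (z.1, w)

lemma exp_mul_gain (U : Pos d → ℝ) (lref : ℝ) (f : State d → ℝ) (x : Pos d) (v : Vel d) :
    Real.exp (-U x) * gain U lref f (x, v) = ∑ w : Vel d, rate U lref x v / totalRate U lref x *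
      (Real.exp (-U x) * (rate U lref x (-(w : Pos d)) * f (x, w))) := by
  rw [gain, Finset.mul_sum, Finset.mul_sum]
  exact Finset.sum_congr rfl fun w _ => by ring

/-- The factor lies in [0, 1], being one term of a sum of nonnegative terms over the whole sum. -/
lemma integrable_rate_div_mul {U : Pos d → ℝ} (hU : ContDiff ℝ 1 U) {lref : ℝ} (hl : 0 < lref)
    {G : Pos d → ℝ} (hG : Integrable G volume) (v : Vel d) :
    Integrable (fun x => rate U lref x v / totalRate U lref x * G x) volume := by
  refine hG.bdd_mul (c := 1) ?_ (Eventually.of_forall fun x => ?_)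
  · exact ((continuous_rate_left hU lref v).div (continuous_totalRate hU lref)
      fun x => (totalRate_pos U hl x).ne').aestronglyMeasurable
  · have h0 : ∀ w : Vel d, 0 ≤ rate U lref x w := fun w => hl.le.trans (rate_ge _ _ _ _)
    rw [Real.norm_of_nonneg (div_nonneg (h0 v) (totalRate_pos U hl x).le),
      div_le_one (totalRate_pos U hl x)]
    exact Finset.single_le_sum (f := fun w : Vel d => rate U lref x w) (fun w _ => h0 w)
      (Finset.mem_univ v)

lemma integrable_gain {U : Pos d → ℝ} (hU : ContDiff ℝ 1 U) {lref : ℝ} (hl : 0 < lref)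
    {f : State d → ℝ} (hf : ∀ v, Continuous fun x => f (x, v))
    (h : ∀ v : Vel d, Integrable
      (fun x => Real.exp (-U x) * (rate U lref x (-(v : Pos d)) * f (x, v))) volume) :
    Integrable (gain U lref f) (refMeasure U) := by
  refine integrable_refMeasure hU (measurable_from_prod_countable_left fun v => ?_) fun v => ?_
  · refine Continuous.measurable ?_
    unfold gain
    refine (continuous_rate_left hU lref v).mul (continuous_finsetSum _ fun w _ => ?_)
    exact ((continuous_rate_left hU lref _).div (continuous_totalRate hU lref)
      fun x => (totalRate_pos U hl x).ne').mul (hf w)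
  · simp only [exp_mul_gain]
    exact integrable_finsetSum _ fun w _ => integrable_rate_div_mul hU hl (h w) v

/-- Summed over the old velocity v, the factors λ(x, v)/λ(x) give one, so only the incoming weight
λ(x, -w) remains. -/
lemma integral_gain {U : Pos d → ℝ} (hU : ContDiff ℝ 1 U) {lref : ℝ} (hl : 0 < lref)
    {f : State d → ℝ} (hf : ∀ v, Continuous fun x => f (x, v))
    (h : ∀ v : Vel d, Integrable
      (fun x => Real.exp (-U x) * (rate U lref x (-(v : Pos d)) * f (x, v))) volume) :
    ∫ z, gain U lref f z ∂(refMeasure U) =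
      ∑ v : Vel d, ∫ x, Real.exp (-U x) * (rate U lref x (-(v : Pos d)) * f (x, v)) := by
  rw [integral_refMeasure hU (integrable_gain hU hl hf h)]
  simp only [exp_mul_gain]
  have hi := fun v w => integrable_rate_div_mul hU hl (h w) v
  calc _ = ∑ v : Vel d, ∑ w : Vel d, ∫ x, rate U lref x v / totalRate U lref x *
        (Real.exp (-U x) * (rate U lref x (-(w : Pos d)) * f (x, w))) :=
        Finset.sum_congr rfl fun v _ => integral_finsetSum _ fun w _ => hi v w
    _ = ∑ w : Vel d, ∑ v : Vel d, ∫ x, rate U lref x v / totalRate U lref x *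
        (Real.exp (-U x) * (rate U lref x (-(w : Pos d)) * f (x, w))) := Finset.sum_comm
    _ = _ := by
        refine Finset.sum_congr rfl fun w _ => ?_
        rw [← integral_finsetSum _ fun v _ => hi v w]
        refine integral_congr_ae (Eventually.of_forall fun x => ?_)
        simp only
        rw [← Finset.sum_mul, ← Finset.sum_div]
        change totalRate U lref x / totalRate U lref x * _ = _
        rw [div_self (totalRate_pos U hl x).ne', one_mul]

/-- The target is infinitesimally invariant. -/
lemma integral_generator {U : Pos d → ℝ} (hU : ContDiff ℝ 1 U)
    (hint : Integrable (fun x => Real.exp (-U x)) volume) {lref : ℝ} (hl : 0 < lref)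
    {f : State d → ℝ} (hf : Admissible U lref f) :
    Integrable (generator U lref f) (target U) ∧
      ∫ z, generator U lref f z ∂(target U) = 0 := by
  have i1 := (integrable_target_iff hU hint).1 hf.integrable_drift
  have i2 := (integrable_target_iff hU hint).1 hf.integrable_rate
  have i3 := (integrable_target_iff hU hint).1 hf.integrable_rate_neg
  have hc : ∀ v, Continuous fun x => f (x, v) := fun v => (hf.differentiable v).continuous
  have s1 := integrable_slice hU i1
  have s2 := integrable_slice hU i2
  have s3 := integrable_slice hU i3
  have i4 := integrable_gain hU hl hc s3
  have hi : Integrable (generator U lref f) (refMeasure U) := (i1.add i4).sub i2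
  refine ⟨(integrable_target_iff hU hint).2 hi, ?_⟩
  have e : ∫ z, generator U lref f z ∂(refMeasure U) =
      ∫ z, drift f z ∂(refMeasure U) + ∫ z, gain U lref f z ∂(refMeasure U) -
        ∫ z, rate U lref z.1 z.2 * f z ∂(refMeasure U) := by
    rw [← integral_add' i1 i4, ← integral_sub' (i1.add i4) i2]
    rfl
  rw [target_eq_smul hU, integral_smul_measure, e, integral_gain hU hl hc s3,
    integral_refMeasure hU i1, integral_refMeasure hU i2, ← Finset.sum_add_distrib,
    ← Finset.sum_sub_distrib, Finset.sum_eq_zero, smul_zero]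
  -- The cancellation takes place separately for each velocity: the drift integral is the loss term
  -- minus the gain term.
  intro v _
  rw [integral_exp_mul_drift hU hl (hf.differentiable v) (s1 v) (s2 v) (s3 v)]
  ring

end IOCS

theorem mainTheorem6 {d : ℕ} (U : IOCS.Pos d → ℝ) (hU : ContDiff ℝ 1 U)
    (hint : Integrable (fun x => Real.exp (-U x)) volume)
    (lref : ℝ) (hl : 0 < lref) :
    (∀ z : IOCS.State d, ∀ᵐ ω ∂(IOCS.skeletonLaw hU hl z),
      StrictMono (fun n => (ω n).1) ∧ Tendsto (fun n => (ω n).1) atTop atTop) ∧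
    (IsProbabilityMeasure (IOCS.target U) ∧
      ∀ t : ℝ, 0 ≤ t →
        IsMarkovKernel (IOCS.transition hU hl t) ∧
        Kernel.Invariant (IOCS.transition hU hl t) (IOCS.target U)) ∧
    (∀ f : IOCS.State d → ℝ, IOCS.Admissible U lref f →
      Integrable (IOCS.generator U lref f) (IOCS.target U) ∧
      ∫ z, IOCS.generator U lref f z ∂(IOCS.target U) = 0) :=
  ⟨IOCS.ae_skeletonLaw_nonexplosive hU hl,
    ⟨IOCS.isProbabilityMeasure_target hint, fun t ht =>
      ⟨IOCS.isMarkovKernel_transition hU hl t, IOCS.invariant_transition hU hl ht⟩⟩,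
    fun _ hf => IOCS.integral_generator hU hint hl hf⟩
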